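/- Let $\alpha>-1/2$. Let $G_n^{(\alpha)}$ be the Gegenbauer polynomials normalized by $G_n^{(\alpha)}(1)=1$: $G_0^{(\alpha)}=1$, $G_1^{(\alpha)}(x)=x$, $(n+2\alpha)G_{n+1}^{(\alpha)}(x)=2(n+\alpha)xG_n^{(\alpha)}(x)-nG_{n-1}^{(\alpha)}(x)$ for $n\ge 1$. Put $$\lambda_j^{(\alpha)}=\frac{2^{2\alpha-1}\,j!\,\Gamma(\alpha+\frac12)^2}{(j+\alpha)\,\Gamma(j+2\alpha)}\quad(\text{for } j=0 \text{ read } \alpha\,\Gamma(2\alpha) \text{ as } \tfrac12\Gamma(2\alpha+1)).$$ For $n\ge 0$ let $q_n^{(\alpha)}=G_{n+1}^{(\alpha)}-G_n^{(\alpha)}$, let $x_{n,0}^{(\alpha)}>\dots>x_{n,n}^{(\alpha)}$ be its zeros, and let $$\aleph_{n,k}=\frac{2^{2\alpha-1}\,\Gamma(\alpha+\frac12)^2\,n!}{(n+\alpha+\frac12)\,\Gamma(n+2\alpha+1)}\,\frac{1+x_{n,k}^{(\alpha)}}{G_n^{(\alpha)}(x_{n,k}^{(\alpha)})^{2}},\qquad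 \varpi_{n,0}=(\alpha+\tfrac12)\,\aleph_{n,0},\qquad \varpi_{n,k}=\aleph_{n,k}\ (1\le k\le n).$$ For $b>0$ put $x_i=x_{b,n,i}^{(\alpha)}=\frac b2\left(x_{n,i}^{(\alpha)}+1\right)$, $q_{b,n}^{(\alpha)}(x)=q_n^{(\alpha)}(2x/b-1)$ and, for $0\le i,k\le n$, $$Q^{(2)}_{b,i,k}=(x_i-x_k)\,\frac b2\sum_{j=0}^n \frac{\varpi_{n,k}}{\lambda_j^{(\alpha)}}\,G_j^{(\alpha)}(x_{n,k}^{(\alpha)})\int_{-1}^{x_{n,i}^{(\alpha)}}G_j^{(\alpha)}(x)\,dx .$$ For $f\in C^{n+1}[0,b]$ let $$E_i=E_{n,i}(f)=\int_0^{x_i}\int_0^x f(t)\,dt\,dx-\sum_{k=0}^n Q^{(2)}_{b,i,k}\,f(x_k)$$ be the truncation error of the second-order shifted quadrature, and let $A_k=\max_{[0,b]}|f^{(n+k)}|$ for $k=0,1$. Then: (a) For all $n\ge 0$, $b>0$, $f\in C^{n+1}[0,b]$ and $0\le i\le n$, $$|E_i|\le \frac{2^{-2n-1}\,x_i\,\Gamma(\alpha+1)\,b^{n+1}\,\Gamma(n+2\alpha+1)\,\left(A_0(n+1)+bA_1\right)}{(n+1)!\,\Gamma(2\alpha+1)\,\Gamma(n+\alpha+1)}\;\max_{[0,b]}\left|q_{b,n}^{(\alpha)}\right|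 .$$ (b) If $\alpha\ge 0$, there is a constant $C^{(\alpha)}>0$, depending only on $\alpha$, such that for all $n\ge 1$, $b>0$, $f\in C^{n+1}[0,b]$ and $0\le i\le n$, $$|E_i|\le b^{n+1}\,C^{(\alpha)}\left(\frac e4\right)^n n^{-\frac32-n+\alpha}\,x_i\left(A_0(n+1)+bA_1\right).$$ (c) If $-\frac12<\alpha<0$, there is a constant $D^{(\alpha)}>0$, depending only on $\alpha$, such that for all $n\ge 1$, $b>0$, $f\in C^{n+1}[0,b]$ and $0\le i\le n$, $$|E_i|\le 2^{-2n-1}\,b^{n+1}\,D^{(\alpha)}\,e^n\, n^{-n-\frac32}\,x_i\left(A_0(n+1)+bA_1\right).$$ -/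

import Mathlib

open Real Set MeasureTheory

noncomputable section

namespace SGQuad

/-- The Gegenbauer polynomial `G_n^{(α)}`, standardized so that `G_n^{(α)}(1) = 1`:
`G_0 = 1`, `G_1 = x`, `(n + 2α) G_{n+1} = 2 (n + α) x G_n - n G_{n-1}` for `n ≥ 1`. -/
def gegenbauer (α : ℝ) : ℕ → Polynomial ℝ
  | 0 => 1
  | 1 => Polynomial.X
  | (n + 2) =>
      Polynomial.C (((n : ℝ) + 1 + 2 * α)⁻¹) *
        (Polynomial.C (2 * ((n : ℝ) + 1 + α)) * Polynomial.X * gegenbauer α (n + 1)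
          - Polynomial.C ((n : ℝ) + 1) * gegenbauer α n)

/-- The normalization factor `λ_n^{(α)} = ∫_{-1}^1 (G_n^{(α)}(x))² (1 - x²)^{α - 1/2} dx`, that is
`2^{2α-1} n! Γ(α+1/2)² / ((n + α) Γ(n + 2α))`. For `n = 0` the denominator `α Γ(2α)` is written
as `Γ(2α + 1) / 2`, which is its continuous extension to `α = 0`. -/
def normFactor (α : ℝ) : ℕ → ℝ
  | 0 => 2 ^ (2 * α - 1) * Gamma (α + 1 / 2) ^ 2 / (Gamma (2 * α + 1) / 2)
  | (n + 1) =>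
      2 ^ (2 * α - 1) * (Nat.factorial (n + 1) : ℝ) * Gamma (α + 1 / 2) ^ 2 /
        (((n : ℝ) + 1 + α) * Gamma ((n : ℝ) + 1 + 2 * α))

/-- `q_n^{(α)} = G_{n+1}^{(α)} - G_n^{(α)}`. -/
def radauPoly (α : ℝ) (n : ℕ) : Polynomial ℝ :=
  gegenbauer α (n + 1) - gegenbauer α n

/-- The flipped-Gegenbauer-Gauss-Radau nodes `x_{n,k}^{(α)}`, `k = 0, …, n`: the zeros of
`q_n^{(α)}` in descending order (the default value `0` of `getD` is never taken, as there are
`n + 1` distinct real zeros for `α > -1/2`). -/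
def node (α : ℝ) (n : ℕ) (k : Fin (n + 1)) : ℝ :=
  ((radauPoly α n).roots.toFinset.sort (fun x y => x ≥ y)).getD k 0

/-- The quantities `ℵ_{n,j}^{(α)}` from which the Christoffel numbers are formed. -/
def aleph (α : ℝ) (n : ℕ) (j : Fin (n + 1)) : ℝ :=
  2 ^ (2 * α - 1) * (Gamma (α + 1 / 2) ^ 2 * (Nat.factorial n : ℝ) /
      (((n : ℝ) + α + 1 / 2) * Gamma ((n : ℝ) + 2 * α + 1))) *
    (1 + node α n j) * (((gegenbauer α n).eval (node α n j)) ^ 2)⁻¹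

/-- The Christoffel numbers `ϖ_{n,j}^{(α)}` of the flipped-Gegenbauer-Gauss-Radau quadrature. -/
def christoffel (α : ℝ) (n : ℕ) (j : Fin (n + 1)) : ℝ :=
  if j = 0 then (α + 1 / 2) * aleph α n j else aleph α n j

/-- The first-order integration matrix `Q^{(1)}` on `[-1, 1]`. -/
def Q1 (α : ℝ) (n : ℕ) : Matrix (Fin (n + 1)) (Fin (n + 1)) ℝ :=
  Matrix.of fun i k =>
    ∑ j ∈ Finset.range (n + 1),
      (normFactor α j)⁻¹ * christoffel α n k * (gegenbauer α j).eval (node α n k) *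
        ∫ x in (-1 : ℝ)..(node α n i), (gegenbauer α j).eval x

/-- The shifted nodes `x_{b,n,k}^{(α)} = (b/2) (x_{n,k}^{(α)} + 1)`. -/
def shiftedNode (α b : ℝ) (n : ℕ) (k : Fin (n + 1)) : ℝ :=
  b / 2 * (node α n k + 1)

/-- The first-order shifted integration matrix `Q_b^{(1)} = (b/2) Q^{(1)}`. -/
def Qb1 (α b : ℝ) (n : ℕ) : Matrix (Fin (n + 1)) (Fin (n + 1)) ℝ :=
  (b / 2) • Q1 α n

/-- The second-order shifted integration matrix,
`Q_{b,i,k}^{(2)} = (x_{b,n,i}^{(α)} - x_{b,n,k}^{(α)}) Q_{b,i,k}^{(1)}`. -/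
def Qb2 (α b : ℝ) (n : ℕ) : Matrix (Fin (n + 1)) (Fin (n + 1)) ℝ :=
  Matrix.of fun i k => (shiftedNode α b n i - shiftedNode α b n k) * Qb1 α b n i k

/-- The shifted polynomial `q_{b,n}^{(α)}(x) = q_n^{(α)}(2x/b - 1)`. -/
def shiftedRadau (α b : ℝ) (n : ℕ) (x : ℝ) : ℝ :=
  (radauPoly α n).eval (2 * x / b - 1)

/-- The truncation error of the second-order shifted quadrature at the `i`-th shifted node:
`∫_0^{x_i} ∫_0^x f(t) dt dx - ∑_k Q_{b,i,k}^{(2)} f(x_k)`. -/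
def truncError2 (α b : ℝ) (n : ℕ) (f : ℝ → ℝ) (i : Fin (n + 1)) : ℝ :=
  (∫ x in (0 : ℝ)..(shiftedNode α b n i), ∫ t in (0 : ℝ)..x, f t) -
    ∑ k : Fin (n + 1), Qb2 α b n i k * f (shiftedNode α b n k)

/-- The uniform norm `‖g‖_{∞,S} = sup {|g x| : x ∈ S}` of a function that is bounded on `S`. -/
def supNorm (g : ℝ → ℝ) (S : Set ℝ) : ℝ :=
  sSup ((fun x => |g x|) '' S)

end SGQuad

end

namespace SGQuad

open Polynomial

/-! ### Gegenbauer polynomials: derivative formulas, differential equation, parity, leading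
coefficient. -/

section Gegenbauer

variable {α : ℝ}

/-! By Cauchy's formula the double integral of `f` up to `x_i` is the single integral of `g(t) =
(x_i - t) f(t)`. The factor `x_i - x_k` in the second-order matrix is that weight at `t = x_k`, so
the quadrature is the first-order one applied to `g`, that is, the integral of the Lagrange
interpolant of `g` at the Radau nodes (`truncError2_eq_integral`). The first-order matrix does
integrate Lagrange polynomials: by Christoffel–Darboux the kernel `∑ G_j(x) G_j(y) / λ_j` vanishes
at two distinct zeros of `G_{n+1} - G_n`, and on the diagonal it is the inverse Christoffel number.
The same identity shows that these zeros are real and simple. The interpolation error is at most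
`max |g^{(n+1)}| / (n+1)!` times the node polynomial. Since the weight is linear, `g^{(n+1)}`
involves only `f^{(n+1)}` and `f^{(n)}`; the node polynomial is `q_{b,n}` over its leading
coefficient. Integrating over `[0, x_i]` gives (a). For (b) and (c), Stirling bounds the factorial,
log-convexity bounds the Gamma quotient by a multiple of `n^α`, and the Sonine function bounds `q_n`
on `[-1, 1]`: by `2` if `α ≥ 0`, by a multiple of `n^(-α)` if `α < 0`. In the second case the powers
`n^α` and `n^(-α)` cancel. -/

lemma natCast_add_one_add_two_mul_pos (hα : -(1 / 2) < α) (n : ℕ) : 0 < (n : ℝ) + 1 + 2 * α := by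
  have : (0 : ℝ) ≤ n := n.cast_nonneg
  linarith

lemma gegenbauer_zero : gegenbauer α 0 = 1 := by rw [gegenbauer]

lemma gegenbauer_one : gegenbauer α 1 = X := by rw [gegenbauer]

/-- The three-term recurrence, cleared of denominators. -/
lemma gegenbauer_recurrence (hα : -(1 / 2) < α) (n : ℕ) :
    ((n : ℝ[X]) + 1 + 2 * C α) * gegenbauer α (n + 2) =
      2 * ((n : ℝ[X]) + 1 + C α) * X * gegenbauer α (n + 1) - ((n : ℝ[X]) + 1) * gegenbauer α n := by
  have h := natCast_add_one_add_two_mul_pos hα n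
  have e : ((n : ℝ[X]) + 1 + 2 * C α) = C ((n : ℝ) + 1 + 2 * α) := by
    simp [show (C 2 : ℝ[X]) = 2 from map_ofNat C 2]
  have e1 : C ((n : ℝ) + 1 + 2 * α) * C (((n : ℝ) + 1 + 2 * α)⁻¹) = 1 := by
    rw [← C_mul, mul_inv_cancel₀ h.ne', C_1]
  rw [gegenbauer, ← mul_assoc, e, e1]
  simp [show (C 2 : ℝ[X]) = 2 from map_ofNat C 2]

lemma natCast_add_one_add_two_mul_C_ne_zero (hα : -(1 / 2) < α) (n : ℕ) :
    ((n : ℝ[X]) + 1 + 2 * C α) ≠ 0 := by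
  have e : ((n : ℝ[X]) + 1 + 2 * C α) = C ((n : ℝ) + 1 + 2 * α) := by
    simp [show (C 2 : ℝ[X]) = 2 from map_ofNat C 2]
  rw [e, Ne, C_eq_zero]
  exact (natCast_add_one_add_two_mul_pos hα n).ne'

/-- The two formulas need each other: the second at `n + 1` is the first at `n` plus the recurrence,
and the first at `n + 1` comes from differentiating the recurrence and inserting both at `n`. -/
lemma derivative_gegenbauer_aux (hα : -(1 / 2) < α) (n : ℕ) :
    (1 - X ^ 2) * derivative (gegenbauer α (n + 1)) =
        ((n : ℝ[X]) + 1) * (gegenbauer α n - X * gegenbauer α (n + 1)) ∧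
      (1 - X ^ 2) * derivative (gegenbauer α n) =
        ((n : ℝ[X]) + 2 * C α) * (X * gegenbauer α n - gegenbauer α (n + 1)) := by
  induction n with
  | zero =>
    simp only [gegenbauer_zero, gegenbauer_one, zero_add]
    constructor
    · simp; ring
    · simp
  | succ n ih =>
    obtain ⟨h1, h2⟩ := ih
    have hr := gegenbauer_recurrence hα n
    have hd := congrArg derivative hr
    simp only [derivative_mul, derivative_sub, derivative_add, derivative_natCast, derivative_one,
      derivative_C, derivative_X, derivative_ofNat] at hd
    have h3 : (1 - X ^ 2) * derivative (gegenbauer α (n + 1)) =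
        ((n : ℝ[X]) + 1 + 2 * C α) * (X * gegenbauer α (n + 1) - gegenbauer α (n + 2)) := by
      linear_combination h1 + hr
    refine ⟨?_, by push_cast; exact h3⟩
    apply mul_left_cancel₀ (natCast_add_one_add_two_mul_C_ne_zero hα n)
    push_cast
    linear_combination (1 - X ^ 2) * hd + 2 * ((n : ℝ[X]) + 1 + C α) * X * h1 -
      ((n : ℝ[X]) + 1) * h2 + ((n : ℝ[X]) + 2) * X * hr

lemma one_sub_sq_mul_derivative_gegenbauer_succ (hα : -(1 / 2) < α) (n : ℕ) :
    (1 - X ^ 2) * derivative (gegenbauer α (n + 1)) =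
      ((n : ℝ[X]) + 1) * (gegenbauer α n - X * gegenbauer α (n + 1)) :=
  (derivative_gegenbauer_aux hα n).1

lemma one_sub_sq_mul_derivative_gegenbauer (hα : -(1 / 2) < α) (n : ℕ) :
    (1 - X ^ 2) * derivative (gegenbauer α n) =
      ((n : ℝ[X]) + 2 * C α) * (X * gegenbauer α n - gegenbauer α (n + 1)) :=
  (derivative_gegenbauer_aux hα n).2

/-- The Gegenbauer differential equation. -/
lemma gegenbauer_ode (hα : -(1 / 2) < α) (n : ℕ) :
    (1 - X ^ 2) * derivative (derivative (gegenbauer α n)) -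
        (2 * C α + 1) * X * derivative (gegenbauer α n) +
      (n : ℝ[X]) * ((n : ℝ[X]) + 2 * C α) * gegenbauer α n = 0 := by
  cases n with
  | zero => simp [gegenbauer_zero]
  | succ n =>
    have h1 := one_sub_sq_mul_derivative_gegenbauer_succ hα n
    have h2 := one_sub_sq_mul_derivative_gegenbauer hα n
    have hd := congrArg derivative h1
    simp only [derivative_mul, derivative_sub, derivative_add, derivative_natCast, derivative_one,
      derivative_X, derivative_X_pow] at hd
    have hne : (1 - X ^ 2 : ℝ[X]) ≠ 0 := by
      intro h
      have := congrArg (eval 0) h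
      simp at this
    apply mul_left_cancel₀ hne
    push_cast
    simp [show (C 2 : ℝ[X]) = 2 from map_ofNat C 2] at hd
    linear_combination (1 - X ^ 2) * hd + ((n : ℝ[X]) + 1) * h2 - ((n : ℝ[X]) + 2 * C α) * X * h1

lemma eval_one_gegenbauer (hα : -(1 / 2) < α) (n : ℕ) : (gegenbauer α n).eval 1 = 1 := by
  induction n using Nat.strong_induction_on with
  | _ n ih =>
    match n with
    | 0 => simp [gegenbauer_zero]
    | 1 => simp [gegenbauer_one]
    | n + 2 =>
      have h := natCast_add_one_add_two_mul_pos hα n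
      have hr := congrArg (eval 1) (gegenbauer_recurrence hα n)
      simp [ih n (by omega), ih (n + 1) (by omega)] at hr
      apply mul_left_cancel₀ h.ne'
      linarith

lemma gegenbauer_eval_neg (hα : -(1 / 2) < α) (n : ℕ) (x : ℝ) :
    (gegenbauer α n).eval (-x) = (-1) ^ n * (gegenbauer α n).eval x := by
  induction n using Nat.strong_induction_on with
  | _ n ih =>
    match n with
    | 0 => simp [gegenbauer_zero]
    | 1 => simp [gegenbauer_one]
    | n + 2 =>
      have h := natCast_add_one_add_two_mul_pos hα n
      have hr := congrArg (eval x) (gegenbauer_recurrence hα n)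
      have hr' := congrArg (eval (-x)) (gegenbauer_recurrence hα n)
      simp [ih n (by omega), ih (n + 1) (by omega)] at hr hr'
      apply mul_left_cancel₀ h.ne'
      rw [hr']
      linear_combination (-1) ^ n * (-hr)

lemma eval_one_derivative_gegenbauer (hα : -(1 / 2) < α) (n : ℕ) :
    (derivative (gegenbauer α n)).eval 1 = n * (n + 2 * α) / (2 * α + 1) := by
  have h := congrArg (eval 1) (gegenbauer_ode hα n)
  simp [eval_one_gegenbauer hα] at h
  rw [eq_div_iff (by linarith)]
  linarith

/-- For `x > 1` the values `G_n(x)` are positive and strictly increasing in `n`. -/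
lemma gegenbauer_lt_of_one_lt (hα : -(1 / 2) < α) {x : ℝ} (hx : 1 < x) (n : ℕ) :
    0 < (gegenbauer α n).eval x ∧ (gegenbauer α n).eval x < (gegenbauer α (n + 1)).eval x := by
  induction n with
  | zero => simp [gegenbauer_zero, gegenbauer_one, hx]
  | succ n ih =>
    have h := natCast_add_one_add_two_mul_pos hα n
    have hn : (0 : ℝ) ≤ n := n.cast_nonneg
    have hr := congrArg (eval x) (gegenbauer_recurrence hα n)
    simp at hr
    have h0 : 0 < (gegenbauer α (n + 1)).eval x := ih.1.trans ih.2
    refine ⟨h0, ?_⟩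
    have h1 : 0 < ((n : ℝ) + 1 + α) * (x - 1) * (gegenbauer α (n + 1)).eval x :=
      mul_pos (mul_pos (by linarith) (by linarith)) h0
    have h2 : 0 ≤ ((n : ℝ) + 1) * ((gegenbauer α (n + 1)).eval x - (gegenbauer α n).eval x) :=
      mul_nonneg (by linarith) (by linarith [ih.2])
    refine lt_of_mul_lt_mul_left ?_ h.le
    nlinarith

lemma gegenbauer_pos_of_one_le (hα : -(1 / 2) < α) {x : ℝ} (hx : 1 ≤ x) (n : ℕ) :
    0 < (gegenbauer α n).eval x := by
  rcases hx.eq_or_lt with rfl | hx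
  · rw [eval_one_gegenbauer hα]; exact one_pos
  · exact (gegenbauer_lt_of_one_lt hα hx n).1

/-- The leading coefficient of `G_n`. -/
noncomputable def gegenbauerLead (α : ℝ) (n : ℕ) : ℝ :=
  2 ^ n * Gamma (n + α) * Gamma (2 * α + 1) / (2 * Gamma (n + 2 * α) * Gamma (α + 1))

lemma gegenbauerLead_succ (n : ℕ) :
    gegenbauerLead α (n + 1) =
      2 ^ n * Gamma (n + α + 1) * Gamma (2 * α + 1) / (Gamma (n + 2 * α + 1) * Gamma (α + 1)) := by
  unfold gegenbauerLead
  push_cast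
  rw [show (n : ℝ) + 1 + α = n + α + 1 by ring, show (n : ℝ) + 1 + 2 * α = n + 2 * α + 1 by ring,
    pow_succ, mul_assoc 2, show 2 ^ n * 2 * Gamma (n + α + 1) * Gamma (2 * α + 1) =
      2 * (2 ^ n * Gamma (n + α + 1) * Gamma (2 * α + 1)) by ring,
    mul_div_mul_left _ _ two_ne_zero]

lemma gegenbauerLead_succ_pos (hα : -(1 / 2) < α) (n : ℕ) : 0 < gegenbauerLead α (n + 1) := by
  have hn : (0 : ℝ) ≤ n := n.cast_nonneg
  rw [gegenbauerLead_succ]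
  have h1 : 0 < Gamma (n + α + 1) := Gamma_pos_of_pos (by linarith)
  have h2 : 0 < Gamma (2 * α + 1) := Gamma_pos_of_pos (by linarith)
  have h3 : 0 < Gamma (n + 2 * α + 1) := Gamma_pos_of_pos (by linarith)
  have h4 : 0 < Gamma (α + 1) := Gamma_pos_of_pos (by linarith)
  positivity

/-- Two consecutive degrees are carried because the recurrence has two steps. The coefficient
formula starts at index 1: at `n = 0`, `α = 0` it would involve `Gamma 0`, which is `0` in Lean. -/
lemma gegenbauer_degree_coeff (hα : -(1 / 2) < α) (n : ℕ) :
    (gegenbauer α n).natDegree ≤ n ∧ (gegenbauer α (n + 1)).natDegree ≤ n + 1 ∧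
      (gegenbauer α (n + 1)).coeff (n + 1) = gegenbauerLead α (n + 1) := by
  induction n with
  | zero =>
    have h2 : 0 < Gamma (2 * α + 1) := Gamma_pos_of_pos (by linarith)
    have h4 : 0 < Gamma (α + 1) := Gamma_pos_of_pos (by linarith)
    refine ⟨by simp [gegenbauer_zero], by simp [gegenbauer_one], ?_⟩
    rw [gegenbauerLead_succ]
    simp only [zero_add, gegenbauer_one, coeff_X_one, pow_zero, one_mul, CharP.cast_eq_zero]
    rw [mul_comm, div_self (by positivity)]
  | succ n ih =>
    obtain ⟨h1, h2, h3⟩ := ih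
    have hn : (0 : ℝ) ≤ n := n.cast_nonneg
    have hpos := natCast_add_one_add_two_mul_pos hα n
    refine ⟨h2, ?_, ?_⟩
    · rw [gegenbauer]
      refine (natDegree_C_mul_le _ _).trans ((natDegree_sub_le _ _).trans (max_le ?_ ?_))
      · rw [mul_assoc]
        refine (natDegree_C_mul_le _ _).trans (natDegree_mul_le.trans ?_)
        rw [natDegree_X]; omega
      · exact (natDegree_C_mul_le _ _).trans (by omega)
    · have hc : (gegenbauer α n).coeff (n + 2) = 0 :=
        coeff_eq_zero_of_natDegree_lt (by omega)
      rw [gegenbauer, mul_assoc, coeff_C_mul, coeff_sub, coeff_C_mul, coeff_C_mul, coeff_X_mul, h3,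
        hc, gegenbauerLead_succ, gegenbauerLead_succ]
      push_cast
      rw [show (n : ℝ) + 1 + α + 1 = (n + α + 1) + 1 by ring,
        show (n : ℝ) + 1 + 2 * α + 1 = (n + 2 * α + 1) + 1 by ring,
        Gamma_add_one (s := n + α + 1) (by linarith),
        Gamma_add_one (s := n + 2 * α + 1) (by linarith)]
      have g3 : 0 < Gamma (n + 2 * α + 1) := Gamma_pos_of_pos (by linarith)
      have g4 : 0 < Gamma (α + 1) := Gamma_pos_of_pos (by linarith)
      have : (n : ℝ) + 2 * α + 1 ≠ 0 := by linarith
      have := hpos.ne'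
      field_simp
      ring

end Gegenbauer

/-! ### Christoffel–Darboux formula, Radau nodes and Christoffel numbers. -/

section ChristoffelDarboux

variable {α : ℝ}

lemma normFactor_pos (hα : -(1 / 2) < α) (n : ℕ) : 0 < normFactor α n := by
  have h1 : 0 < Gamma (α + 1 / 2) := Gamma_pos_of_pos (by linarith)
  cases n with
  | zero =>
    have h2 : 0 < Gamma (2 * α + 1) := Gamma_pos_of_pos (by linarith)
    simp only [normFactor]
    positivity
  | succ n =>
    have h := natCast_add_one_add_two_mul_pos hα n
    have h2 : 0 < Gamma ((n : ℝ) + 1 + 2 * α) := Gamma_pos_of_pos h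
    have h3 : 0 < (n : ℝ) + 1 + α := by
      have : (0 : ℝ) ≤ n := n.cast_nonneg
      linarith
    simp only [normFactor]
    positivity

/-- The constant in the Christoffel–Darboux formula. -/
noncomputable def darbouxConst (α : ℝ) (n : ℕ) : ℝ :=
  Gamma (n + 2 * α + 1) / (2 ^ (2 * α) * (Nat.factorial n : ℝ) * Gamma (α + 1 / 2) ^ 2)

lemma two_rpow_two_mul_sub_one (α : ℝ) : (2 : ℝ) ^ (2 * α - 1) = 2 ^ (2 * α) / 2 := by
  rw [rpow_sub two_pos, rpow_one]

lemma inv_normFactor_zero : (normFactor α 0)⁻¹ = darbouxConst α 0 := by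
  simp only [normFactor, darbouxConst, two_rpow_two_mul_sub_one]
  simp
  field_simp

/-- A common factor `d` removes Gamma functions and factorials from the induction steps below,
leaving only the coefficients of the recurrence. -/
lemma exists_darbouxConst_relation (hα : -(1 / 2) < α) (n : ℕ) :
    ∃ d : ℝ, (normFactor α (n + 1))⁻¹ = 2 * (n + 1 + α) * d ∧
      darbouxConst α (n + 1) = (n + 1 + 2 * α) * d ∧ darbouxConst α n = (n + 1) * d := by
  have h1 : 0 < Gamma (α + 1 / 2) := Gamma_pos_of_pos (by linarith)
  have h := natCast_add_one_add_two_mul_pos hα n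
  have hn : (0 : ℝ) ≤ n := n.cast_nonneg
  have h2 : 0 < Gamma ((n : ℝ) + 1 + 2 * α) := Gamma_pos_of_pos h
  have h3 : (0 : ℝ) < n + 1 := by linarith
  have h4 : (0 : ℝ) < n + 1 + α := by linarith
  have h5 : (0 : ℝ) < Nat.factorial n := by positivity
  have h6 : (0 : ℝ) < 2 ^ (2 * α) := by positivity
  refine ⟨Gamma (n + 1 + 2 * α) /
    (2 ^ (2 * α) * (Nat.factorial (n + 1) : ℝ) * Gamma (α + 1 / 2) ^ 2), ?_, ?_, ?_⟩
  · simp only [normFactor, two_rpow_two_mul_sub_one, Nat.factorial_succ]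
    push_cast
    field_simp
  · simp only [darbouxConst, Nat.factorial_succ]
    push_cast
    rw [Gamma_add_one h.ne']
    ring
  · simp only [darbouxConst, Nat.factorial_succ]
    push_cast
    rw [show (n : ℝ) + 2 * α + 1 = n + 1 + 2 * α by ring]
    field_simp

/-- The algebra is general because the formula is needed over `ℂ`, for reality of the zeros, and
over `ℝ`, for the Lagrange property. -/
lemma christoffel_darboux (hα : -(1 / 2) < α) {A : Type*} [CommRing A] [Algebra ℝ A] (z w : A)
    (n : ℕ) :
    (z - w) * ∑ j ∈ Finset.range (n + 1), algebraMap ℝ A (normFactor α j)⁻¹ *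
        aeval z (gegenbauer α j) * aeval w (gegenbauer α j) =
      algebraMap ℝ A (darbouxConst α n) *
        (aeval z (gegenbauer α (n + 1)) * aeval w (gegenbauer α n) -
          aeval z (gegenbauer α n) * aeval w (gegenbauer α (n + 1))) := by
  induction n with
  | zero =>
    simp [gegenbauer_zero, gegenbauer_one, inv_normFactor_zero]
    ring
  | succ n ih =>
    obtain ⟨d, h1, h2, h3⟩ := exists_darbouxConst_relation hα n
    rw [Finset.sum_range_succ, mul_add, ih, h1, h2, h3]
    have hz := congrArg (aeval z) (gegenbauer_recurrence hα n)
    have hw := congrArg (aeval w) (gegenbauer_recurrence hα n)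
    simp only [map_mul, map_add, map_sub, map_natCast, map_one, map_ofNat, aeval_X, aeval_C]
      at hz hw ⊢
    linear_combination algebraMap ℝ A d * (aeval z (gegenbauer α (n + 1)) * hw -
      aeval w (gegenbauer α (n + 1)) * hz)

/-- The confluent Christoffel–Darboux formula. -/
lemma christoffel_darboux_confluent (hα : -(1 / 2) < α) (x : ℝ) (n : ℕ) :
    ∑ j ∈ Finset.range (n + 1), (normFactor α j)⁻¹ *
        (gegenbauer α j).eval x * (gegenbauer α j).eval x =
      darbouxConst α n *
        ((derivative (gegenbauer α (n + 1))).eval x * (gegenbauer α n).eval x -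
          (derivative (gegenbauer α n)).eval x * (gegenbauer α (n + 1)).eval x) := by
  induction n with
  | zero => simp [gegenbauer_zero, gegenbauer_one, inv_normFactor_zero]
  | succ n ih =>
    obtain ⟨d, h1, h2, h3⟩ := exists_darbouxConst_relation hα n
    rw [Finset.sum_range_succ, ih, h1, h2, h3]
    have hr := gegenbauer_recurrence hα n
    have hd := congrArg (eval x) (congrArg derivative hr)
    have hr := congrArg (eval x) hr
    simp at hr hd
    linear_combination d * ((derivative (gegenbauer α (n + 1))).eval x * hr -
      (gegenbauer α (n + 1)).eval x * hd)

lemma kernel_diag_pos (hα : -(1 / 2) < α) (z : ℂ) (n : ℕ) :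
    0 < ∑ j ∈ Finset.range (n + 1), (normFactor α j)⁻¹ *
      Complex.normSq (aeval z (gegenbauer α j)) := by
  rw [Finset.sum_range_succ']
  refine add_pos_of_nonneg_of_pos (Finset.sum_nonneg fun j _ => ?_) ?_
  · exact mul_nonneg (inv_nonneg.2 (normFactor_pos hα _).le) (Complex.normSq_nonneg _)
  · simpa [gegenbauer_zero] using normFactor_pos hα 0

/-- The complex zeros of the Radau polynomial are real. -/
lemma im_eq_zero_of_aeval_radauPoly (hα : -(1 / 2) < α) (n : ℕ) {z : ℂ}
    (hz : aeval z (radauPoly α n) = 0) : z.im = 0 := by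
  have hconj : ∀ p : ℝ[X], aeval (starRingEnd ℂ z) p = starRingEnd ℂ (aeval z p) := fun p => by
    simpa using (aeval_algHom_apply Complex.conjAe.toAlgHom z p)
  -- With `w` the conjugate of `z`, the right side vanishes at a zero of `q_n`, while the kernel is
  -- a positive combination of the `|G_j(z)|²`; hence `z - w = 0`.
  have h := christoffel_darboux hα z (starRingEnd ℂ z) n
  rw [radauPoly, map_sub, sub_eq_zero] at hz
  rw [hconj, hconj, hz, sub_self, mul_zero, mul_eq_zero] at h
  rcases h with h | h
  · have := congrArg Complex.im h
    simp at this
    linarith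
  · exfalso
    refine (kernel_diag_pos hα z n).ne' ?_
    rw [← Complex.ofReal_inj, Complex.ofReal_zero, ← h, Complex.ofReal_sum]
    refine Finset.sum_congr rfl fun j _ => ?_
    rw [hconj, mul_assoc, Complex.mul_conj, Complex.ofReal_mul]
    rfl

lemma kernel_self_pos (hα : -(1 / 2) < α) (x : ℝ) (n : ℕ) :
    0 < ∑ j ∈ Finset.range (n + 1), (normFactor α j)⁻¹ *
      (gegenbauer α j).eval x * (gegenbauer α j).eval x := by
  rw [Finset.sum_range_succ']
  refine add_pos_of_nonneg_of_pos (Finset.sum_nonneg fun j _ => ?_) ?_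
  · rw [mul_assoc]
    exact mul_nonneg (inv_nonneg.2 (normFactor_pos hα _).le) (mul_self_nonneg _)
  · simpa [gegenbauer_zero] using normFactor_pos hα 0

lemma radauPoly_natDegree_coeff (hα : -(1 / 2) < α) (n : ℕ) :
    (radauPoly α n).natDegree = n + 1 ∧
      (radauPoly α n).leadingCoeff = gegenbauerLead α (n + 1) := by
  obtain ⟨h1, h2, h3⟩ := gegenbauer_degree_coeff hα n
  have hc : (radauPoly α n).coeff (n + 1) = gegenbauerLead α (n + 1) := by
    rw [radauPoly, coeff_sub, h3, coeff_eq_zero_of_natDegree_lt (by omega : _ < n + 1), sub_zero]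
  have hd : (radauPoly α n).natDegree = n + 1 := by
    refine le_antisymm ((natDegree_sub_le _ _).trans (max_le h2 (by omega))) ?_
    exact le_natDegree_of_ne_zero (by rw [hc]; exact (gegenbauerLead_succ_pos hα n).ne')
  exact ⟨hd, by rw [leadingCoeff, hd, hc]⟩

lemma radauPoly_ne_zero (hα : -(1 / 2) < α) (n : ℕ) : radauPoly α n ≠ 0 := by
  intro h
  have := (radauPoly_natDegree_coeff hα n).1
  simp [h] at this

lemma radauPoly_splits (hα : -(1 / 2) < α) (n : ℕ) : (radauPoly α n).Splits := by
  refine Splits.of_splits_map (algebraMap ℝ ℂ) (IsAlgClosed.splits _) ?_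
  intro z hz
  have h0 : aeval z (radauPoly α n) = 0 := by
    have := (mem_roots'.1 hz).2
    rwa [IsRoot.def, eval_map_algebraMap] at this
  exact ⟨z.re, Complex.ext rfl (by simp [im_eq_zero_of_aeval_radauPoly hα n h0])⟩

/-- At a double zero the confluent formula would make the positive diagonal kernel vanish. -/
lemma derivative_radauPoly_eval_ne_zero (hα : -(1 / 2) < α) (n : ℕ) {x : ℝ}
    (hx : (radauPoly α n).eval x = 0) : (derivative (radauPoly α n)).eval x ≠ 0 := by
  intro h
  have hk := kernel_self_pos hα x n
  rw [christoffel_darboux_confluent hα] at hk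
  simp only [radauPoly, derivative_sub, eval_sub, sub_eq_zero] at hx h
  rw [hx, h] at hk
  simp at hk

lemma radauPoly_card_roots (hα : -(1 / 2) < α) (n : ℕ) :
    (radauPoly α n).roots.toFinset.card = n + 1 := by
  rw [Multiset.toFinset_card_of_nodup, ← (radauPoly_splits hα n).natDegree_eq_card_roots,
    (radauPoly_natDegree_coeff hα n).1]
  rw [Multiset.nodup_iff_count_le_one]
  intro x
  rw [count_roots]
  by_contra! h
  have hx := (one_lt_rootMultiplicity_iff_isRoot (radauPoly_ne_zero hα n)).1 h
  exact derivative_radauPoly_eval_ne_zero hα n hx.1 hx.2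

lemma node_list_length (hα : -(1 / 2) < α) (n : ℕ) :
    ((radauPoly α n).roots.toFinset.sort (fun x y => x ≥ y)).length = n + 1 := by
  rw [Finset.length_sort, radauPoly_card_roots hα]

lemma node_eq_getElem (hα : -(1 / 2) < α) (n : ℕ) (k : Fin (n + 1)) :
    node α n k = ((radauPoly α n).roots.toFinset.sort (fun x y => x ≥ y))[(k : ℕ)]'(by
      rw [node_list_length hα]; exact k.2) := by
  unfold node
  rw [List.getD_eq_getElem]

lemma node_strictAnti (hα : -(1 / 2) < α) (n : ℕ) : StrictAnti (node α n) := by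
  intro i j hij
  rw [node_eq_getElem hα, node_eq_getElem hα]
  exact (Finset.sortedGT_sort _).strictAnti_get (a := ⟨i, _⟩) (b := ⟨j, _⟩) hij

lemma node_isRoot (hα : -(1 / 2) < α) (n : ℕ) (k : Fin (n + 1)) :
    (radauPoly α n).eval (node α n k) = 0 := by
  have h : node α n k ∈ (radauPoly α n).roots.toFinset := by
    rw [← Finset.mem_sort (fun x y => x ≥ y), node_eq_getElem hα]
    exact List.getElem_mem _
  exact (mem_roots'.1 (Multiset.mem_toFinset.1 h)).2

lemma gegenbauer_succ_eval_node (hα : -(1 / 2) < α) (n : ℕ) (k : Fin (n + 1)) :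
    (gegenbauer α (n + 1)).eval (node α n k) = (gegenbauer α n).eval (node α n k) := by
  have := node_isRoot hα n k
  rwa [radauPoly, eval_sub, sub_eq_zero] at this

lemma image_node (hα : -(1 / 2) < α) (n : ℕ) :
    Finset.univ.image (node α n) = (radauPoly α n).roots.toFinset := by
  apply Finset.eq_of_subset_of_card_le
  · intro x hx
    obtain ⟨k, -, rfl⟩ := Finset.mem_image.1 hx
    exact Multiset.mem_toFinset.2 (mem_roots'.2 ⟨radauPoly_ne_zero hα n, node_isRoot hα n k⟩)
  · rw [Finset.card_image_of_injective _ (node_strictAnti hα n).injective, radauPoly_card_roots hα]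
    simp

lemma exists_node_eq (hα : -(1 / 2) < α) (n : ℕ) {x : ℝ} (hx : (radauPoly α n).eval x = 0) :
    ∃ k, node α n k = x := by
  have h : x ∈ Finset.univ.image (node α n) := by
    rw [image_node hα]
    exact Multiset.mem_toFinset.2 (mem_roots'.2 ⟨radauPoly_ne_zero hα n, hx⟩)
  simpa using h

lemma node_le_one (hα : -(1 / 2) < α) (n : ℕ) (k : Fin (n + 1)) : node α n k ≤ 1 := by
  by_contra! h
  exact (gegenbauer_lt_of_one_lt hα h n).2.ne' (gegenbauer_succ_eval_node hα n k)

/-- At a node `x ≤ -1`, parity gives `G_n(-x)` and `G_{n+1}(-x)` opposite signs, yet both are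
positive since `-x ≥ 1`. -/
lemma neg_one_lt_node (hα : -(1 / 2) < α) (n : ℕ) (k : Fin (n + 1)) : -1 < node α n k := by
  by_contra! h
  have h' : 1 ≤ -node α n k := by linarith
  have h0 := gegenbauer_pos_of_one_le hα h' n
  have h1 := gegenbauer_pos_of_one_le hα h' (n + 1)
  rw [gegenbauer_eval_neg hα] at h0 h1
  rw [gegenbauer_succ_eval_node hα, pow_succ] at h1
  linarith

lemma node_eq_one_iff (hα : -(1 / 2) < α) (n : ℕ) (k : Fin (n + 1)) : node α n k = 1 ↔ k = 0 := by
  obtain ⟨l, hl⟩ := exists_node_eq hα n (x := 1) (by simp [radauPoly, eval_one_gegenbauer hα])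
  have h0 : node α n 0 = 1 :=
    le_antisymm (node_le_one hα n 0) (hl ▸ (node_strictAnti hα n).antitone (Fin.zero_le l))
  rw [← h0]
  exact (node_strictAnti hα n).injective.eq_iff

lemma radauPoly_eval_eq_prod (hα : -(1 / 2) < α) (n : ℕ) (x : ℝ) :
    (radauPoly α n).eval x = gegenbauerLead α (n + 1) * ∏ k, (x - node α n k) := by
  have h := radauPoly_splits hα n
  have h1 : (radauPoly α n).roots = (Finset.univ : Finset (Fin (n + 1))).val.map (node α n) := by
    rw [← Finset.image_val_of_injOn (node_strictAnti hα n).injective.injOn, image_node hα,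
      Multiset.toFinset_val, eq_comm, Multiset.dedup_eq_self, ← Multiset.toFinset_card_eq_card_iff_nodup,
      radauPoly_card_roots hα, ← h.natDegree_eq_card_roots, (radauPoly_natDegree_coeff hα n).1]
  rw [h.eval_eq_prod_roots, (radauPoly_natDegree_coeff hα n).2, h1, Multiset.map_map]
  rfl

/-- The Christoffel numbers are the reciprocals of the kernel on the diagonal. -/
lemma christoffel_mul_kernel (hα : -(1 / 2) < α) (n : ℕ) (k : Fin (n + 1)) :
    christoffel α n k * ∑ j ∈ Finset.range (n + 1), (normFactor α j)⁻¹ *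
      (gegenbauer α j).eval (node α n k) * (gegenbauer α j).eval (node α n k) = 1 := by
  have hk := kernel_self_pos hα (node α n k) n
  rw [christoffel_darboux_confluent hα, gegenbauer_succ_eval_node hα] at hk ⊢
  have hg : (gegenbauer α n).eval (node α n k) ≠ 0 := by
    intro h
    simp [h] at hk
  have hn : (0 : ℝ) ≤ n := n.cast_nonneg
  have hG : 0 < Gamma (α + 1 / 2) := Gamma_pos_of_pos (by linarith)
  have hG2 : 0 < Gamma (n + 2 * α + 1) := Gamma_pos_of_pos (by linarith)
  have hs : (n : ℝ) + α + 1 / 2 = (2 * (n + α) + 1) / 2 := by ring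
  have hs' : 2 * ((n : ℝ) + α) + 1 ≠ 0 := by linarith
  have h2 : (0 : ℝ) < 2 ^ (2 * α) := by positivity
  have hf : (0 : ℝ) < Nat.factorial n := by positivity
  have hα1 : 2 * α + 1 ≠ 0 := by linarith
  -- At the node `1` the derivatives come from the differential equation: `G_{n+1}' - G_n'` equals
  -- `(2n + 2α + 1) / (2α + 1)` there, which accounts for the extra factor `α + 1/2`.
  by_cases h0 : k = 0
  · have hx := (node_eq_one_iff hα n k).2 h0
    rw [christoffel, if_pos h0, aleph, hx, eval_one_gegenbauer hα,
      eval_one_derivative_gegenbauer hα, eval_one_derivative_gegenbauer hα, darbouxConst,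
      two_rpow_two_mul_sub_one, hs]
    generalize Gamma (α + 1 / 2) = g at hG ⊢
    generalize Gamma (n + 2 * α + 1) = g' at hG2 ⊢
    push_cast
    have hα2 : α * 2 + 1 ≠ 0 := by linarith
    field_simp
    ring
  · have hx : node α n k ≠ 1 := fun h => h0 ((node_eq_one_iff hα n k).1 h)
    have hx1 : 1 - node α n k ≠ 0 := sub_ne_zero.2 hx.symm
    have d1 := congrArg (eval (node α n k)) (one_sub_sq_mul_derivative_gegenbauer_succ hα n)
    have d2 := congrArg (eval (node α n k)) (one_sub_sq_mul_derivative_gegenbauer hα n)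
    simp [gegenbauer_succ_eval_node hα] at d1 d2
    -- Both derivative formulas carry a factor `1 - x` once `G_{n+1} = G_n`; cancelling it leaves
    -- the `1 + x` of `aleph`.
    have key : (1 + node α n k) * ((derivative (gegenbauer α (n + 1))).eval (node α n k) -
        (derivative (gegenbauer α n)).eval (node α n k)) =
        (2 * n + 2 * α + 1) * (gegenbauer α n).eval (node α n k) := by
      apply mul_left_cancel₀ hx1
      linear_combination d1 - d2
    rw [christoffel, if_neg h0, aleph, darbouxConst, two_rpow_two_mul_sub_one, hs]
    generalize Gamma (α + 1 / 2) = g at hG ⊢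
    generalize Gamma (n + 2 * α + 1) = g' at hG2 ⊢
    field_simp
    linear_combination key

/-- The Lagrange basis polynomials at the Radau nodes, in terms of the Gegenbauer kernel. -/
lemma christoffel_mul_kernel_eq_lagrange (hα : -(1 / 2) < α) (n : ℕ) (k l : Fin (n + 1)) :
    ∑ j ∈ Finset.range (n + 1), (normFactor α j)⁻¹ * christoffel α n k *
      (gegenbauer α j).eval (node α n k) * (gegenbauer α j).eval (node α n l) =
      if l = k then 1 else 0 := by
  have e : ∑ j ∈ Finset.range (n + 1), (normFactor α j)⁻¹ * christoffel α n k *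
      (gegenbauer α j).eval (node α n k) * (gegenbauer α j).eval (node α n l) =
      christoffel α n k * ∑ j ∈ Finset.range (n + 1), (normFactor α j)⁻¹ *
      (gegenbauer α j).eval (node α n k) * (gegenbauer α j).eval (node α n l) := by
    rw [Finset.mul_sum]
    exact Finset.sum_congr rfl fun j _ => by ring
  rw [e]
  split_ifs with h
  · rw [h]
    exact christoffel_mul_kernel hα n k
  · have hcd := christoffel_darboux hα (node α n k) (node α n l) n
    simp only [coe_aeval_eq_eval, Algebra.algebraMap_self, RingHom.id_apply,
      gegenbauer_succ_eval_node hα, sub_self, mul_zero, mul_eq_zero] at hcd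
    rcases hcd with hcd | hcd
    · exact absurd ((node_strictAnti hα n).injective (sub_eq_zero.1 hcd)).symm h
    · rw [hcd, mul_zero]

end ChristoffelDarboux

/-! ### Interpolation error, derivatives of the weighted function, Cauchy's repeated integral. -/

section Interpolation

/-- Generalized Rolle theorem: a function with `m + 1` zeros has a zero of its `m`-th derivative. -/
lemma exists_iteratedDerivWithin_eq_zero {a b : ℝ} (hab : a < b) (m : ℕ) (h : ℝ → ℝ)
    (hc : ContDiffOn ℝ m h (Icc a b)) (z : Fin (m + 1) → ℝ) (hz : StrictMono z)
    (hmem : ∀ i, z i ∈ Icc a b) (h0 : ∀ i, h (z i) = 0) :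
    ∃ ξ ∈ Icc a b, iteratedDerivWithin m h (Icc a b) ξ = 0 := by
  induction m generalizing h with
  | zero => exact ⟨z 0, hmem 0, by simp [h0]⟩
  | succ m ih =>
    have hrolle : ∀ i : Fin (m + 1), ∃ c ∈ Ioo (z i.castSucc) (z i.succ), deriv h c = 0 := by
      intro i
      refine exists_deriv_eq_zero (hz i.castSucc_lt_succ)
        (hc.continuousOn.mono (Icc_subset_Icc (hmem _).1 (hmem _).2)) (by rw [h0, h0])
    choose w hw hw0 using hrolle
    have hwI : ∀ i, w i ∈ Ioo a b := fun i =>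
      ⟨(hmem _).1.trans_lt (hw i).1, (hw i).2.trans_le (hmem _).2⟩
    obtain ⟨ξ, hξ, e⟩ := ih (derivWithin h (Icc a b))
      (hc.derivWithin (uniqueDiffOn_Icc hab) (by simp)) w
      (Fin.strictMono_iff_lt_succ.2 fun i => by
        refine (hw _).2.trans_le (le_trans (le_of_eq ?_) (hw _).1.le)
        rw [Fin.succ_castSucc])
      (fun i => Ioo_subset_Icc_self (hwI i)) (fun i => by
        rw [derivWithin_of_mem_nhds (Icc_mem_nhds (hwI i).1 (hwI i).2), hw0])
    exact ⟨ξ, hξ, by rw [iteratedDerivWithin_succ', e]⟩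

lemma iteratedDerivWithin_polynomial {a b : ℝ} (hab : a < b) (p : ℝ[X]) (m : ℕ) {x : ℝ}
    (hx : x ∈ Icc a b) :
    iteratedDerivWithin m (fun t => p.eval t) (Icc a b) x = (derivative^[m] p).eval x := by
  induction m generalizing p with
  | zero => simp
  | succ m ih =>
    rw [iteratedDerivWithin_succ', Function.iterate_succ_apply, ← ih (derivative p)]
    exact iteratedDerivWithin_congr
      (fun t ht => p.derivWithin (uniqueDiffOn_Icc hab t ht)) hx

lemma iterate_derivative_of_natDegree_le {p : ℝ[X]} {m : ℕ} (hp : p.natDegree ≤ m) :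
    derivative^[m] p = C ((Nat.factorial m : ℝ) * p.coeff m) := by
  have hd : (derivative^[m] p).natDegree = 0 := by
    have := natDegree_iterate_derivative p m
    omega
  rw [eq_C_of_natDegree_eq_zero hd, coeff_iterate_derivative]
  simp [Nat.descFactorial_self]

/-- The error of polynomial interpolation at `n + 1` distinct nodes. -/
lemma abs_sub_interpolant_le {a b : ℝ} (hab : a < b) {n : ℕ} {g : ℝ → ℝ}
    (hg : ContDiffOn ℝ ((n + 1 : ℕ) : WithTop ℕ∞) g (Icc a b)) {x : Fin (n + 1) → ℝ}
    (hx : Function.Injective x) (hxI : ∀ k, x k ∈ Icc a b) {p : ℝ[X]} (hp : p.natDegree ≤ n)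
    (hpx : ∀ k, p.eval (x k) = g (x k)) {M : ℝ}
    (hM : ∀ t ∈ Icc a b, |iteratedDerivWithin (n + 1) g (Icc a b) t| ≤ M) {t : ℝ}
    (ht : t ∈ Icc a b) :
    |g t - p.eval t| ≤ M / (Nat.factorial (n + 1)) * |∏ k, (t - x k)| := by
  have hf : (0 : ℝ) < Nat.factorial (n + 1) := by positivity
  by_cases hk : ∃ k, x k = t
  · obtain ⟨k, rfl⟩ := hk
    rw [hpx, sub_self, Finset.prod_eq_zero (Finset.mem_univ k) (sub_self _)]
    simp
  set W : ℝ[X] := ∏ k, (X - C (x k)) with hW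
  have hWt : ∀ s, W.eval s = ∏ k, (s - x k) := fun s => by simp [hW, eval_prod]
  have hWne : W.eval t ≠ 0 := by
    rw [hWt]
    exact Finset.prod_ne_zero_iff.2 fun k _ h => hk ⟨k, (sub_eq_zero.1 h).symm⟩
  have hWm : W.Monic := monic_prod_of_monic _ _ fun k _ => monic_X_sub_C _
  have hWd : W.natDegree = n + 1 := by simp [hW]
  -- This `κ` makes `g - p - κ W` vanish at `t` as well as at the nodes: `n + 2` zeros, enough for
  -- Rolle at order `n + 1`, where the polynomial part contributes `(n + 1)! κ`.
  set κ : ℝ := (g t - p.eval t) / W.eval t with hκ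
  set r : ℝ[X] := p + C κ * W with hr
  have hrd : r.natDegree ≤ n + 1 :=
    (natDegree_add_le _ _).trans (max_le (by omega) ((natDegree_C_mul_le _ _).trans hWd.le))
  have hrc : r.coeff (n + 1) = κ := by
    rw [hr, coeff_add, coeff_C_mul, coeff_eq_zero_of_natDegree_lt (by omega), ← hWd,
      hWm.coeff_natDegree]
    ring
  have hrs : ContDiffOn ℝ ((n + 1 : ℕ) : WithTop ℕ∞) (fun s => r.eval s) (Icc a b) := by
    simpa using (r.contDiff_aeval (𝕜 := ℝ) ((n + 1 : ℕ) : WithTop ℕ∞)).contDiffOn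
  have hh : ContDiffOn ℝ ((n + 1 : ℕ) : WithTop ℕ∞) (g - fun s => r.eval s) (Icc a b) :=
    hg.sub hrs
  have hcard : (insert t (Finset.univ.image x)).card = n + 1 + 1 := by
    rw [Finset.card_insert_of_notMem (by simpa using hk), Finset.card_image_of_injective _ hx]
    simp
  have hmem : ∀ i, (insert t (Finset.univ.image x)).orderEmbOfFin hcard i = t ∨
      ∃ k, x k = (insert t (Finset.univ.image x)).orderEmbOfFin hcard i := fun i => by
    simpa only [Finset.mem_insert, Finset.mem_image, Finset.mem_univ, true_and] using
      Finset.orderEmbOfFin_mem _ hcard i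
  obtain ⟨ξ, hξ, e⟩ := exists_iteratedDerivWithin_eq_zero hab (n + 1) _ hh
    ((insert t (Finset.univ.image x)).orderEmbOfFin hcard)
    (OrderEmbedding.strictMono _)
    (fun i => by
      rcases hmem i with h | ⟨k, h⟩
      · rwa [h]
      · rw [← h]; exact hxI k)
    (fun i => by
      rcases hmem i with h | ⟨k, h⟩
      · rw [h]
        simp only [Pi.sub_apply, hr, eval_add, eval_mul, eval_C, hκ]
        field_simp
        ring
      · rw [← h]
        simp only [Pi.sub_apply, hr, eval_add, eval_mul, eval_C, hWt, hpx]
        rw [Finset.prod_eq_zero (Finset.mem_univ k) (sub_self _)]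
        ring)
  rw [iteratedDerivWithin_sub hξ (uniqueDiffOn_Icc hab) (hg ξ hξ) (hrs ξ hξ),
    iteratedDerivWithin_polynomial hab r _ hξ, iterate_derivative_of_natDegree_le hrd, hrc,
    eval_C, sub_eq_zero] at e
  have hb := hM ξ hξ
  rw [e, abs_mul, abs_of_pos hf] at hb
  have hgt : g t - p.eval t = κ * ∏ k, (t - x k) := by
    rw [← hWt, hκ, div_mul_cancel₀ _ hWne]
  rw [hgt, abs_mul]
  gcongr
  rwa [le_div_iff₀ hf, mul_comm]

/-- Leibniz's rule with a linear factor has only two terms; they are the source of `A₁` and `A₀`. -/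
lemma iteratedDerivWithin_const_sub_mul {a b : ℝ} (hab : a < b) (c : ℝ) (n : ℕ) {f : ℝ → ℝ}
    (hf : ContDiffOn ℝ ((n + 1 : ℕ) : WithTop ℕ∞) f (Icc a b)) {x : ℝ} (hx : x ∈ Icc a b) :
    iteratedDerivWithin (n + 1) (fun t => (c - t) * f t) (Icc a b) x =
      (c - x) * iteratedDerivWithin (n + 1) f (Icc a b) x -
        (n + 1) * iteratedDerivWithin n f (Icc a b) x := by
  have hu := uniqueDiffOn_Icc hab
  have hder : ∀ m ≤ n, ∀ y ∈ Icc a b, HasDerivWithinAt (iteratedDerivWithin m f (Icc a b))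
      (iteratedDerivWithin (m + 1) f (Icc a b) y) (Icc a b) y := by
    intro m hm y hy
    rw [iteratedDerivWithin_succ]
    refine (hf.differentiableOn_iteratedDerivWithin ?_ hu y hy).hasDerivWithinAt
    exact_mod_cast Nat.lt_succ_of_le hm
  have hlin : ∀ y ∈ Icc a b, HasDerivWithinAt (fun t => c - t) (-1) (Icc a b) y :=
    fun y _ => (hasDerivWithinAt_id y _).const_sub c
  suffices H : ∀ m ≤ n, ∀ y ∈ Icc a b,
      iteratedDerivWithin (m + 1) (fun t => (c - t) * f t) (Icc a b) y =
        (c - y) * iteratedDerivWithin (m + 1) f (Icc a b) y -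
          (m + 1) * iteratedDerivWithin m f (Icc a b) y from H n le_rfl x hx
  intro m
  induction m with
  | zero =>
    intro hm y hy
    have h0 := hder 0 hm y hy
    rw [iteratedDerivWithin_zero] at h0
    rw [iteratedDerivWithin_succ, iteratedDerivWithin_zero,
      ((hlin y hy).fun_mul h0).derivWithin (hu y hy), iteratedDerivWithin_zero]
    push_cast
    ring
  | succ m ih =>
    intro hm y hy
    have h0 := hder (m + 1) hm y hy
    have h1 := hder m (by omega) y hy
    rw [iteratedDerivWithin_succ, derivWithin_congr (ih (by omega)) (ih (by omega) y hy),
      (((hlin y hy).fun_mul h0).fun_sub (h1.const_mul _)).derivWithin (hu y hy)]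
    push_cast
    ring

/-- Cauchy's formula for a twofold repeated integral. -/
lemma integral_integral_eq_integral_const_sub_mul {f : ℝ → ℝ} {c : ℝ} (hc : 0 ≤ c)
    (hf : ContinuousOn f (Icc 0 c)) :
    ∫ x in (0 : ℝ)..c, ∫ t in (0 : ℝ)..x, f t = ∫ t in (0 : ℝ)..c, (c - t) * f t := by
  -- Extending by constants makes the integrand continuous on the whole line, so its primitive has
  -- two-sided derivatives at the endpoints too.
  set F : ℝ → ℝ := IccExtend hc ((Icc 0 c).domRestrict f) with hF
  have hFc : Continuous F := hf.domRestrict.Icc_extend'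
  have hFe : ∀ t ∈ Icc 0 c, F t = f t := fun t ht => by
    rw [hF, IccExtend_of_mem _ _ ht, domRestrict_apply]
  have h1 : ∫ x in (0 : ℝ)..c, ∫ t in (0 : ℝ)..x, f t =
      ∫ x in (0 : ℝ)..c, ∫ t in (0 : ℝ)..x, F t := by
    refine intervalIntegral.integral_congr fun x hx => ?_
    rw [uIcc_of_le hc] at hx
    refine intervalIntegral.integral_congr fun t ht => ?_
    rw [uIcc_of_le hx.1] at ht
    exact (hFe t ⟨ht.1, ht.2.trans hx.2⟩).symm
  have h2 : ∫ t in (0 : ℝ)..c, (c - t) * f t = ∫ t in (0 : ℝ)..c, (c - t) * F t := by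
    refine intervalIntegral.integral_congr fun t ht => ?_
    rw [uIcc_of_le hc] at ht
    simp only [hFe t ht]
  have hP : ∀ x, HasDerivAt (fun x => ∫ t in (0 : ℝ)..x, F t) (F x) x := fun x =>
    intervalIntegral.integral_hasDerivAt_right (hFc.intervalIntegrable _ _)
      hFc.stronglyMeasurable.stronglyMeasurableAtFilter hFc.continuousAt
  have hPc : Continuous fun x => ∫ t in (0 : ℝ)..x, F t :=
    continuous_iff_continuousAt.2 fun x => (hP x).continuousAt
  -- Integration by parts: this product vanishes at both ends of `[0, c]`.
  have hD : ∀ x ∈ uIcc 0 c, HasDerivAt (fun x => (c - x) * ∫ t in (0 : ℝ)..x, F t)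
      ((c - x) * F x - ∫ t in (0 : ℝ)..x, F t) x := fun x _ => by
    refine (((hasDerivAt_id' x).const_sub c).fun_mul (hP x)).congr_deriv ?_
    ring
  have hint := intervalIntegral.integral_eq_sub_of_hasDerivAt hD
    ((Continuous.sub (by fun_prop) hPc).intervalIntegrable _ _)
  rw [intervalIntegral.integral_sub (Continuous.intervalIntegrable (by fun_prop) _ _)
    (hPc.intervalIntegrable _ _)] at hint
  simp at hint
  rw [h1, h2]
  linarith

end Interpolation

/-! ### The truncation error as an integrated interpolation error. -/

section TruncationError

lemma supNorm_nonneg (g : ℝ → ℝ) (S : Set ℝ) : 0 ≤ supNorm g S :=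
  Real.sSup_nonneg (by rintro _ ⟨x, -, rfl⟩; exact abs_nonneg _)

lemma abs_le_supNorm {g : ℝ → ℝ} {a b : ℝ} (hg : ContinuousOn g (Icc a b)) {x : ℝ}
    (hx : x ∈ Icc a b) : |g x| ≤ supNorm g (Icc a b) :=
  le_csSup (isCompact_Icc.image_of_continuousOn hg.abs).bddAbove ⟨x, hx, rfl⟩

lemma supNorm_le {g : ℝ → ℝ} {S : Set ℝ} {M : ℝ} (hM : 0 ≤ M) (h : ∀ x ∈ S, |g x| ≤ M) :
    supNorm g S ≤ M :=
  Real.sSup_le (by rintro _ ⟨x, hx, rfl⟩; exact h x hx) hM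

variable {α b : ℝ}

lemma shiftedNode_pos (hα : -(1 / 2) < α) (hb : 0 < b) (n : ℕ) (k : Fin (n + 1)) :
    0 < shiftedNode α b n k := by
  have := neg_one_lt_node hα n k
  exact mul_pos (by linarith) (by linarith)

lemma shiftedNode_le (hα : -(1 / 2) < α) (hb : 0 < b) (n : ℕ) (k : Fin (n + 1)) :
    shiftedNode α b n k ≤ b := by
  have := node_le_one hα n k
  unfold shiftedNode
  nlinarith

lemma two_div_mul_shiftedNode_sub_one (hb : 0 < b) (n : ℕ) (k : Fin (n + 1)) :
    2 / b * shiftedNode α b n k - 1 = node α n k := by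
  unfold shiftedNode
  field_simp
  ring

lemma shiftedNode_injective (hα : -(1 / 2) < α) (hb : 0 < b) (n : ℕ) :
    Function.Injective (shiftedNode α b n) := fun k l h => by
  rw [← (node_strictAnti hα n).injective.eq_iff, ← two_div_mul_shiftedNode_sub_one hb, h,
    two_div_mul_shiftedNode_sub_one hb]

/-- The Lagrange basis polynomials at the Radau nodes. -/
noncomputable def radauBasis (α : ℝ) (n : ℕ) (k : Fin (n + 1)) : ℝ[X] :=
  ∑ j ∈ Finset.range (n + 1),
    C ((normFactor α j)⁻¹ * christoffel α n k * (gegenbauer α j).eval (node α n k)) *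
      gegenbauer α j

lemma radauBasis_eval_node (hα : -(1 / 2) < α) (n : ℕ) (k l : Fin (n + 1)) :
    (radauBasis α n k).eval (node α n l) = if l = k then 1 else 0 := by
  rw [← christoffel_mul_kernel_eq_lagrange hα, radauBasis, eval_finsetSum]
  simp

lemma radauBasis_natDegree (hα : -(1 / 2) < α) (n : ℕ) (k : Fin (n + 1)) :
    (radauBasis α n k).natDegree ≤ n := by
  refine natDegree_sum_le_of_forall_le _ _ fun j hj => ?_
  have := (gegenbauer_degree_coeff hα j).1
  have := Finset.mem_range.1 hj
  exact (natDegree_C_mul_le _ _).trans (by omega)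

lemma integral_radauBasis (n : ℕ) (i k : Fin (n + 1)) :
    ∫ x in (-1 : ℝ)..(node α n i), (radauBasis α n k).eval x = Q1 α n i k := by
  simp only [radauBasis, eval_finsetSum, eval_mul, eval_C, Q1, Matrix.of_apply]
  rw [intervalIntegral.integral_finsetSum]
  · simp
  · intro j _
    exact Continuous.intervalIntegrable (by fun_prop) _ _

lemma integral_radauBasis_comp (hb : 0 < b) (n : ℕ) (i k : Fin (n + 1)) :
    ∫ t in (0 : ℝ)..(shiftedNode α b n i), (radauBasis α n k).eval (2 / b * t - 1) =
      Qb1 α b n i k := by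
  rw [intervalIntegral.integral_comp_mul_sub (fun x => (radauBasis α n k).eval x)
    (by positivity : 2 / b ≠ 0), two_div_mul_shiftedNode_sub_one hb, mul_zero, zero_sub,
    integral_radauBasis]
  simp [Qb1]

/-- The polynomial interpolating `g` at the shifted Radau nodes. -/
noncomputable def radauInterpolant (α b : ℝ) (n : ℕ) (g : ℝ → ℝ) : ℝ[X] :=
  ∑ k, C (g (shiftedNode α b n k)) * (radauBasis α n k).comp (C (2 / b) * X - 1)

lemma radauInterpolant_eval (n : ℕ) (g : ℝ → ℝ) (t : ℝ) :
    (radauInterpolant α b n g).eval t =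
      ∑ k, g (shiftedNode α b n k) * (radauBasis α n k).eval (2 / b * t - 1) := by
  simp [radauInterpolant, eval_finsetSum]

lemma radauInterpolant_eval_shiftedNode (hα : -(1 / 2) < α) (hb : 0 < b) (n : ℕ) (g : ℝ → ℝ)
    (k : Fin (n + 1)) :
    (radauInterpolant α b n g).eval (shiftedNode α b n k) = g (shiftedNode α b n k) := by
  rw [radauInterpolant_eval, two_div_mul_shiftedNode_sub_one hb]
  simp [radauBasis_eval_node hα]

lemma radauInterpolant_natDegree (hα : -(1 / 2) < α) (n : ℕ) (g : ℝ → ℝ) :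
    (radauInterpolant α b n g).natDegree ≤ n := by
  refine natDegree_sum_le_of_forall_le _ _ fun k _ => (natDegree_C_mul_le _ _).trans ?_
  refine natDegree_comp_le.trans ?_
  have h1 : (C (2 / b) * X - 1 : ℝ[X]).natDegree ≤ 1 :=
    (natDegree_sub_le _ _).trans (max_le ((natDegree_C_mul_le _ _).trans natDegree_X_le)
      (by simp))
  calc _ ≤ n * 1 := Nat.mul_le_mul (radauBasis_natDegree hα n k) h1
    _ = n := mul_one n

lemma integral_radauInterpolant (hb : 0 < b) (n : ℕ) (g : ℝ → ℝ) (i : Fin (n + 1)) :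
    ∫ t in (0 : ℝ)..(shiftedNode α b n i), (radauInterpolant α b n g).eval t =
      ∑ k, Qb1 α b n i k * g (shiftedNode α b n k) := by
  simp only [radauInterpolant_eval]
  rw [intervalIntegral.integral_finsetSum]
  · refine Finset.sum_congr rfl fun k _ => ?_
    rw [intervalIntegral.integral_const_mul, integral_radauBasis_comp hb, mul_comm]
  · intro j _
    exact Continuous.intervalIntegrable (by fun_prop) _ _

/-- Cauchy's formula on the integral side and `x_i - x_k` on the matrix side are the same weight, so
the second-order error is a first-order error. -/
lemma truncError2_eq_integral (hα : -(1 / 2) < α) (hb : 0 < b) (n : ℕ) {f : ℝ → ℝ}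
    (hf : ContinuousOn f (Icc 0 b)) (i : Fin (n + 1)) :
    truncError2 α b n f i = ∫ t in (0 : ℝ)..(shiftedNode α b n i),
      ((shiftedNode α b n i - t) * f t -
        (radauInterpolant α b n fun t => (shiftedNode α b n i - t) * f t).eval t) := by
  have h0 := (shiftedNode_pos hα hb n i).le
  have hfc : ContinuousOn f (Icc 0 (shiftedNode α b n i)) :=
    hf.mono (Icc_subset_Icc le_rfl (shiftedNode_le hα hb n i))
  rw [intervalIntegral.integral_sub, integral_radauInterpolant hb, truncError2,
    integral_integral_eq_integral_const_sub_mul h0 hfc]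
  · congr 1
    refine Finset.sum_congr rfl fun k _ => ?_
    simp only [Qb2, Matrix.of_apply]
    ring
  · refine ContinuousOn.intervalIntegrable ?_
    rw [uIcc_of_le h0]
    exact ContinuousOn.mul (by fun_prop) hfc
  · exact Continuous.intervalIntegrable (by fun_prop) _ _

lemma shiftedRadau_eq_prod (hα : -(1 / 2) < α) (hb : 0 < b) (n : ℕ) (t : ℝ) :
    shiftedRadau α b n t =
      gegenbauerLead α (n + 1) * (2 / b) ^ (n + 1) * ∏ k, (t - shiftedNode α b n k) := by
  have h : ∏ k, (2 * t / b - 1 - node α n k) =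
      (2 / b) ^ (n + 1) * ∏ k, (t - shiftedNode α b n k) := by
    have : (2 / b) ^ (n + 1) = ∏ _k : Fin (n + 1), 2 / b := by simp [div_pow]
    rw [this, ← Finset.prod_mul_distrib]
    refine Finset.prod_congr rfl fun k _ => ?_
    rw [← two_div_mul_shiftedNode_sub_one (α := α) hb]
    ring
  rw [shiftedRadau, radauPoly_eval_eq_prod hα, h, mul_assoc]

lemma continuous_shiftedRadau (n : ℕ) : Continuous (shiftedRadau α b n) := by
  unfold shiftedRadau
  fun_prop

lemma abs_truncError2_le (hα : -(1 / 2) < α) (hb : 0 < b) (n : ℕ) {f : ℝ → ℝ}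
    (hf : ContDiffOn ℝ ((n + 1 : ℕ) : WithTop ℕ∞) f (Icc 0 b)) (i : Fin (n + 1)) :
    |truncError2 α b n f i| ≤
      (supNorm (iteratedDerivWithin n f (Icc 0 b)) (Icc 0 b) * (n + 1) +
          b * supNorm (iteratedDerivWithin (n + 1) f (Icc 0 b)) (Icc 0 b)) /
        (Nat.factorial (n + 1)) * ((b / 2) ^ (n + 1) / gegenbauerLead α (n + 1) *
          supNorm (shiftedRadau α b n) (Icc 0 b)) * shiftedNode α b n i := by
  set A₀ := supNorm (iteratedDerivWithin n f (Icc 0 b)) (Icc 0 b) with hA₀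
  set A₁ := supNorm (iteratedDerivWithin (n + 1) f (Icc 0 b)) (Icc 0 b) with hA₁
  set c := shiftedNode α b n i with hc
  have hc0 : 0 < c := shiftedNode_pos hα hb n i
  have hcb : c ≤ b := shiftedNode_le hα hb n i
  have hu := uniqueDiffOn_Icc hb
  have hlead := gegenbauerLead_succ_pos hα n
  have hM : ∀ t ∈ Icc 0 b,
      |iteratedDerivWithin (n + 1) (fun t => (c - t) * f t) (Icc 0 b) t| ≤
        A₀ * (n + 1) + b * A₁ := by
    intro t ht
    rw [iteratedDerivWithin_const_sub_mul hb c n hf ht]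
    have h0 : |iteratedDerivWithin n f (Icc 0 b) t| ≤ A₀ := abs_le_supNorm
      (hf.continuousOn_iteratedDerivWithin (by exact_mod_cast n.le_succ) hu) ht
    have h1 : |iteratedDerivWithin (n + 1) f (Icc 0 b) t| ≤ A₁ := abs_le_supNorm
      (hf.continuousOn_iteratedDerivWithin le_rfl hu) ht
    have h2 : |c - t| ≤ b := abs_le.2 ⟨by linarith [ht.2], by linarith [ht.1]⟩
    have h3 : |(n : ℝ) + 1| = n + 1 := abs_of_pos (by positivity)
    calc _ ≤ |(c - t) * iteratedDerivWithin (n + 1) f (Icc 0 b) t| +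
          |((n : ℝ) + 1) * iteratedDerivWithin n f (Icc 0 b) t| := abs_sub _ _
      _ ≤ b * A₁ + (n + 1) * A₀ := by
        rw [abs_mul, abs_mul, h3]
        gcongr
      _ = _ := by ring
  have hM0 : 0 ≤ A₀ * (n + 1) + b * A₁ := (abs_nonneg _).trans (hM 0 (left_mem_Icc.2 hb.le))
  have hg : ContDiffOn ℝ ((n + 1 : ℕ) : WithTop ℕ∞) (fun t => (c - t) * f t) (Icc 0 b) :=
    (contDiff_const.sub contDiff_id).contDiffOn.mul hf
  rw [truncError2_eq_integral hα hb n hf.continuousOn, ← Real.norm_eq_abs]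
  -- The integrand is bounded by a constant, and the length of the interval supplies the factor
  -- `x_i`.
  refine (intervalIntegral.norm_integral_le_of_norm_le_const (fun t ht => ?_)).trans
    (le_of_eq (by rw [sub_zero, abs_of_pos hc0]))
  rw [uIoc_of_le hc0.le] at ht
  have htb : t ∈ Icc 0 b := ⟨ht.1.le, ht.2.trans hcb⟩
  refine (abs_sub_interpolant_le hb hg (shiftedNode_injective hα hb n)
    (fun k => ⟨(shiftedNode_pos hα hb n k).le, shiftedNode_le hα hb n k⟩)
    (radauInterpolant_natDegree hα n _)
    (radauInterpolant_eval_shiftedNode hα hb n _) hM htb).trans ?_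
  refine mul_le_mul_of_nonneg_left ?_ (by positivity)
  have hs := abs_le_supNorm (continuous_shiftedRadau (α := α) (b := b) n).continuousOn htb
  rw [shiftedRadau_eq_prod hα hb, abs_mul, abs_of_pos (by positivity)] at hs
  calc |∏ k, (t - shiftedNode α b n k)| = (b / 2) ^ (n + 1) / gegenbauerLead α (n + 1) *
        (gegenbauerLead α (n + 1) * (2 / b) ^ (n + 1) * |∏ k, (t - shiftedNode α b n k)|) := by
        rw [div_pow, div_pow]
        field_simp
    _ ≤ _ := by gcongr

end TruncationError

/-! ### Bounds for Gamma quotients and factorials. -/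

section Asymptotics

/-- Since `log Γ` is convex, its slope on `[z, z + s]` is at most its slope on `[z + s, z + s + 1]`,
which is `log (z + s)`. -/
lemma Gamma_add_le_rpow_mul_Gamma {z s : ℝ} (hz : 0 < z) (hs : 0 ≤ s) :
    Gamma (z + s) ≤ (z + s) ^ s * Gamma z := by
  rcases hs.eq_or_lt with rfl | hs
  · simp
  have hzs : 0 < z + s := by linarith
  have h := convexOn_log_Gamma.slope_mono_adjacent (x := z) (y := z + s) (z := z + s + 1)
    hz (by simp only [mem_Ioi]; linarith) (by linarith) (by linarith)
  have hG1 := Gamma_pos_of_pos hz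
  have hG2 := Gamma_pos_of_pos hzs
  simp only [Function.comp, Gamma_add_one hzs.ne', log_mul hzs.ne' hG2.ne', add_sub_cancel_left,
    div_one, add_sub_cancel_right] at h
  rw [div_le_iff₀ hs] at h
  rw [← log_le_log_iff hG2 (by positivity), log_mul (by positivity) hG1.ne', log_rpow hzs]
  linarith

lemma exists_Gamma_ratio_le {α : ℝ} (hα : -(1 / 2) < α) :
    ∃ K : ℝ, 0 < K ∧ ∀ n : ℕ, 1 ≤ n →
      Gamma (n + 2 * α + 1) ≤ K * (n : ℝ) ^ α * Gamma (n + α + 1) := by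
  rcases le_or_gt 0 α with h | h
  · refine ⟨(2 + 2 * α) ^ α, by positivity, fun n hn => ?_⟩
    have hn' : (1 : ℝ) ≤ n := by exact_mod_cast hn
    have hG : 0 < Gamma (n + α + 1) := Gamma_pos_of_pos (by linarith)
    have h1 := Gamma_add_le_rpow_mul_Gamma (z := n + α + 1) (by linarith) h
    rw [show (n : ℝ) + α + 1 + α = n + 2 * α + 1 by ring] at h1
    refine h1.trans ?_
    rw [← mul_rpow (by linarith) (by linarith)]
    gcongr
    nlinarith
  · refine ⟨3 ^ (1 + α), by positivity, fun n hn => ?_⟩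
    have hn' : (1 : ℝ) ≤ n := by exact_mod_cast hn
    have hG : 0 < Gamma (n + α + 1) := Gamma_pos_of_pos (by linarith)
    have hG2 : 0 < Gamma (n + 2 * α + 1) := Gamma_pos_of_pos (by linarith)
    -- The shift `α` is negative here, so one moves up by `1 + α` instead and then divides by `n +
    -- 2α + 1 ≥ n`.
    have h1 := Gamma_add_le_rpow_mul_Gamma (z := n + α + 1) (s := 1 + α) (by linarith)
      (by linarith)
    rw [show (n : ℝ) + α + 1 + (1 + α) = n + 2 * α + 1 + 1 by ring,
      Gamma_add_one (by linarith)] at h1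
    have h2 : ((n : ℝ) + 2 * α + 1 + 1) ^ (1 + α) ≤ 3 ^ (1 + α) * n * n ^ α := by
      rw [mul_assoc, ← rpow_one_add' (by linarith) (by linarith),
        ← mul_rpow (by norm_num) (by linarith)]
      exact rpow_le_rpow (by linarith) (by linarith) (by linarith)
    have h3 : (n : ℝ) * Gamma (n + 2 * α + 1) ≤
        (n : ℝ) * (3 ^ (1 + α) * n ^ α * Gamma (n + α + 1)) :=
      calc _ ≤ (n + 2 * α + 1) * Gamma (n + 2 * α + 1) := by gcongr; linarith
        _ ≤ _ := h1
        _ ≤ 3 ^ (1 + α) * n * n ^ α * Gamma (n + α + 1) := by gcongr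
        _ = _ := by ring
    exact le_of_mul_le_mul_left h3 (by linarith)

/-- Stirling's lower bound with `√(2π)` weakened to `1`, together with `(n + 1)! ≥ n · n!`. -/
lemma inv_factorial_succ_le {n : ℕ} (hn : 1 ≤ n) :
    ((Nat.factorial (n + 1) : ℝ))⁻¹ ≤ exp 1 ^ n * (n : ℝ) ^ (-(n : ℝ) - 3 / 2) := by
  have hn' : (1 : ℝ) ≤ n := by exact_mod_cast hn
  have hn0 : (0 : ℝ) < n := by linarith
  have h1 := Stirling.le_factorial_stirling n
  have h2 : √(n : ℝ) ≤ √(2 * π * n) := sqrt_le_sqrt (by nlinarith [pi_gt_three])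
  have h3 : (n : ℝ) * (√n * (n / exp 1) ^ n) ≤ Nat.factorial (n + 1) := by
    rw [Nat.factorial_succ]
    push_cast
    gcongr
    · linarith
    · exact (mul_le_mul_of_nonneg_right h2 (by positivity)).trans h1
  have h4 : exp 1 ^ n * (n : ℝ) ^ (-(n : ℝ) - 3 / 2) =
      ((n : ℝ) * (√n * (n / exp 1) ^ n))⁻¹ := by
    rw [show -(n : ℝ) - 3 / 2 = -(1 + (1 / 2 + n)) by ring, rpow_neg hn0.le, rpow_add hn0,
      rpow_add hn0, rpow_one, rpow_natCast, ← sqrt_eq_rpow, div_pow]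
    field_simp
  rw [h4]
  gcongr

end Asymptotics

/-! ### Uniform bounds on `[-1, 1]` by the Sonine function. -/

section Bounds

variable {α : ℝ}

/-- The Sonine function `n (n + 2α) G_n² + (1 - X²) G_n'²`. -/
noncomputable def soninePoly (α : ℝ) (n : ℕ) : ℝ[X] :=
  (n : ℝ[X]) * ((n : ℝ[X]) + 2 * C α) * gegenbauer α n ^ 2 +
    (1 - X ^ 2) * derivative (gegenbauer α n) ^ 2

/-- The differential equation cancels all other terms, so on `[0, 1]` the sign of `α` decides
whether the Sonine function increases or decreases. -/
lemma derivative_soninePoly (hα : -(1 / 2) < α) (n : ℕ) :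
    derivative (soninePoly α n) = 4 * C α * X * derivative (gegenbauer α n) ^ 2 := by
  have h := gegenbauer_ode hα n
  simp only [soninePoly, derivative_mul, derivative_sub, derivative_add, derivative_natCast,
    derivative_one, derivative_C, derivative_pow, derivative_ofNat]
  simp [show (C 2 : ℝ[X]) = 2 from map_ofNat C 2]
  linear_combination 2 * derivative (gegenbauer α n) * h

lemma soninePoly_eval (n : ℕ) (x : ℝ) :
    (soninePoly α n).eval x = n * (n + 2 * α) * (gegenbauer α n).eval x ^ 2 +
      (1 - x ^ 2) * (derivative (gegenbauer α n)).eval x ^ 2 := by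
  simp [soninePoly]

lemma abs_gegenbauer_abs (hα : -(1 / 2) < α) (n : ℕ) (x : ℝ) :
    |(gegenbauer α n).eval (|x|)| = |(gegenbauer α n).eval x| := by
  rcases abs_choice x with h | h <;> rw [h]
  rw [gegenbauer_eval_neg hα, abs_mul, abs_pow, abs_neg, abs_one, one_pow, one_mul]

lemma soninePoly_le_eval (n : ℕ) {x : ℝ} (hx : x ∈ Icc (0 : ℝ) 1) :
    n * (n + 2 * α) * (gegenbauer α n).eval x ^ 2 ≤ (soninePoly α n).eval x := by
  rw [soninePoly_eval]
  have h : 0 ≤ 1 - x ^ 2 := by nlinarith [hx.1, hx.2]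
  nlinarith [mul_nonneg h (sq_nonneg ((derivative (gegenbauer α n)).eval x))]

lemma abs_mem_Icc_zero_one {x : ℝ} (hx : x ∈ Icc (-1 : ℝ) 1) : |x| ∈ Icc (0 : ℝ) 1 :=
  ⟨abs_nonneg x, abs_le.2 hx⟩

/-- By parity take `x ≥ 0`. The Sonine function increases to its value `n (n + 2α)` at `1`, and
dominates `n (n + 2α) G_n²`. -/
lemma abs_gegenbauer_le_one (hα : 0 ≤ α) (n : ℕ) {x : ℝ} (hx : x ∈ Icc (-1 : ℝ) 1) :
    |(gegenbauer α n).eval x| ≤ 1 := by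
  have hα' : -(1 / 2) < α := by linarith
  rcases n.eq_zero_or_pos with rfl | hn
  · simp [gegenbauer_zero]
  have hn' : (0 : ℝ) < n := by exact_mod_cast hn
  have hmono : MonotoneOn (fun t => (soninePoly α n).eval t) (Icc 0 1) := by
    refine monotoneOn_of_deriv_nonneg (convex_Icc 0 1) (soninePoly α n).continuousOn
      (soninePoly α n).differentiableOn fun t ht => ?_
    rw [interior_Icc] at ht
    have := ht.1
    rw [Polynomial.deriv, derivative_soninePoly hα']
    simp
    positivity
  have hx' := abs_mem_Icc_zero_one hx
  have h1 := (soninePoly_le_eval (α := α) n hx').trans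
    (hmono hx' (right_mem_Icc.2 zero_le_one) hx'.2)
  simp only [soninePoly_eval, eval_one_gegenbauer hα'] at h1
  rw [← sq_abs, abs_gegenbauer_abs hα'] at h1
  have h2 : |(gegenbauer α n).eval x| ^ 2 ≤ 1 :=
    le_of_mul_le_mul_left (a := (n : ℝ) * (n + 2 * α)) (by linarith) (by positivity)
  nlinarith [abs_nonneg ((gegenbauer α n).eval x)]

lemma mul_gegenbauer_sq_le_soninePoly_zero (hα : -(1 / 2) < α) (hα0 : α ≤ 0) (n : ℕ) {x : ℝ}
    (hx : x ∈ Icc (-1 : ℝ) 1) :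
    n * (n + 2 * α) * (gegenbauer α n).eval x ^ 2 ≤ (soninePoly α n).eval 0 := by
  have hanti : AntitoneOn (fun t => (soninePoly α n).eval t) (Icc 0 1) := by
    refine antitoneOn_of_deriv_nonpos (convex_Icc 0 1) (soninePoly α n).continuousOn
      (soninePoly α n).differentiableOn fun t ht => ?_
    rw [interior_Icc] at ht
    rw [Polynomial.deriv, derivative_soninePoly hα]
    simp only [eval_mul, eval_pow, eval_C, eval_X, eval_ofNat]
    have h : 0 ≤ -α * t * (derivative (gegenbauer α n)).eval t ^ 2 :=
      mul_nonneg (mul_nonneg (by linarith) ht.1.le) (sq_nonneg _)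
    linarith
  have hx' := abs_mem_Icc_zero_one hx
  have h1 := (soninePoly_le_eval (α := α) n hx').trans
    (hanti (left_mem_Icc.2 zero_le_one) hx' hx'.1)
  rwa [← sq_abs, abs_gegenbauer_abs hα, sq_abs] at h1

lemma gegenbauer_odd_eval_zero (hα : -(1 / 2) < α) (m : ℕ) :
    (gegenbauer α (2 * m + 1)).eval 0 = 0 := by
  have h := gegenbauer_eval_neg hα (2 * m + 1) 0
  rw [neg_zero, pow_succ, pow_mul] at h
  simp at h
  linarith

/-- At `0` the recurrence links `G_{2m+2}` to `G_{2m}` alone, so the values form a telescoping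
product of Gamma quotients. -/
lemma abs_gegenbauer_even_eval_zero (hα : -(1 / 2) < α) (m : ℕ) :
    |(gegenbauer α (2 * m)).eval 0| =
      Gamma (m + 1 / 2) * Gamma (α + 1 / 2) / (Gamma (m + α + 1 / 2) * Gamma (1 / 2)) := by
  induction m with
  | zero =>
    have h1 : 0 < Gamma (α + 1 / 2) := Gamma_pos_of_pos (by linarith)
    have h2 : 0 < Gamma (1 / 2) := Gamma_pos_of_pos (by norm_num)
    simp only [mul_zero, gegenbauer_zero, eval_one, abs_one, CharP.cast_eq_zero, zero_add]
    rw [mul_comm, div_self (by positivity)]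
  | succ m ih =>
    have hm : (0 : ℝ) ≤ m := m.cast_nonneg
    have hpos : 0 < (m : ℝ) + α + 1 / 2 := by linarith
    have h1 : 0 < Gamma (m + α + 1 / 2) := Gamma_pos_of_pos hpos
    have h2 : 0 < Gamma (1 / 2) := Gamma_pos_of_pos (by norm_num)
    have hr := congrArg (eval 0) (gegenbauer_recurrence hα (2 * m))
    simp at hr
    have h3 : (gegenbauer α (2 * m + 2)).eval 0 =
        -((m + 1 / 2) / (m + α + 1 / 2) * (gegenbauer α (2 * m)).eval 0) := by
      rw [div_mul_eq_mul_div, ← neg_div, eq_div_iff hpos.ne']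
      linear_combination hr / 2
    rw [show 2 * (m + 1) = 2 * m + 2 by ring, h3, abs_neg, abs_mul, ih,
      abs_of_pos (by positivity)]
    push_cast
    rw [show (m : ℝ) + 1 + 1 / 2 = m + 1 / 2 + 1 by ring,
      show (m : ℝ) + 1 + α + 1 / 2 = m + α + 1 / 2 + 1 by ring,
      Gamma_add_one (by positivity), Gamma_add_one hpos.ne', div_mul_div_comm]
    congr 1 <;> ring

/-- At `0` one term of the Sonine function vanishes: `G_n'(0) = 0` for even `n`, while for odd `n`
one has `G_n(0) = 0` and `G_n'(0) = n G_{n-1}(0)`. The odd case leaves `n / (n + 2α) ≤ 1 / (1 +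
2α)`. -/
lemma gegenbauer_sq_le_of_nonpos (hα : -(1 / 2) < α) (hα0 : α ≤ 0) (m n : ℕ)
    (hn : n = 2 * m ∨ n = 2 * m + 1) {x : ℝ} (hx : x ∈ Icc (-1 : ℝ) 1) :
    (1 + 2 * α) * (gegenbauer α n).eval x ^ 2 ≤ (gegenbauer α (2 * m)).eval 0 ^ 2 := by
  have h := mul_gegenbauer_sq_le_soninePoly_zero hα hα0 n hx
  rw [soninePoly_eval] at h
  have hm : (0 : ℝ) ≤ m := m.cast_nonneg
  rcases hn with hn | hn
  · subst hn
    rcases m.eq_zero_or_pos with rfl | hm0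
    · simp [gegenbauer_zero]
      linarith
    obtain ⟨l, rfl⟩ : ∃ l, m = l + 1 := ⟨m - 1, by omega⟩
    have hd := congrArg (eval 0) (one_sub_sq_mul_derivative_gegenbauer_succ hα (2 * l + 1))
    simp [gegenbauer_odd_eval_zero hα] at hd
    rw [show 2 * (l + 1) = 2 * l + 1 + 1 by ring] at h ⊢
    rw [hd] at h
    push_cast at h
    have hl : (0 : ℝ) ≤ l := l.cast_nonneg
    have h1 : (gegenbauer α (2 * l + 1 + 1)).eval x ^ 2 ≤
        (gegenbauer α (2 * l + 1 + 1)).eval 0 ^ 2 :=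
      le_of_mul_le_mul_left (a := (2 * (l : ℝ) + 1 + 1) * (2 * l + 1 + 1 + 2 * α))
        (by linarith) (mul_pos (by linarith) (by linarith))
    nlinarith [sq_nonneg ((gegenbauer α (2 * l + 1 + 1)).eval x)]
  · subst hn
    have hd := congrArg (eval 0) (one_sub_sq_mul_derivative_gegenbauer_succ hα (2 * m))
    simp at hd
    rw [gegenbauer_odd_eval_zero hα, hd] at h
    push_cast at h
    have hp : (0 : ℝ) < 2 * m + 1 := by linarith
    have h1 : (2 * (m : ℝ) + 1 + 2 * α) * (gegenbauer α (2 * m + 1)).eval x ^ 2 ≤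
        (2 * m + 1) * (gegenbauer α (2 * m)).eval 0 ^ 2 :=
      le_of_mul_le_mul_left (a := 2 * (m : ℝ) + 1) (by linarith) hp
    have h2 : (2 * (m : ℝ) + 1) * ((1 + 2 * α) * (gegenbauer α (2 * m + 1)).eval x ^ 2) ≤
        (2 * (m : ℝ) + 1 + 2 * α) * (gegenbauer α (2 * m + 1)).eval x ^ 2 := by
      rw [← mul_assoc]
      refine mul_le_mul_of_nonneg_right ?_ (sq_nonneg _)
      nlinarith
    exact le_of_mul_le_mul_left (h2.trans h1) hp

lemma exists_abs_gegenbauer_le_of_neg (hα : -(1 / 2) < α) (hα0 : α ≤ 0) :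
    ∃ K : ℝ, 0 < K ∧ ∀ n : ℕ, ∀ x ∈ Icc (-1 : ℝ) 1,
      |(gegenbauer α n).eval x| ≤ K * ((n : ℝ) + 1) ^ (-α) := by
  have hG1 : 0 < Gamma (α + 1 / 2) := Gamma_pos_of_pos (by linarith)
  have hG2 : 0 < Gamma (1 / 2) := Gamma_pos_of_pos (by norm_num)
  have hs : 0 < √(1 + 2 * α) := sqrt_pos.2 (by linarith)
  refine ⟨Gamma (α + 1 / 2) / Gamma (1 / 2) / √(1 + 2 * α), by positivity, fun n x hx => ?_⟩
  obtain ⟨m, hm⟩ : ∃ m, n = 2 * m ∨ n = 2 * m + 1 := ⟨n / 2, by omega⟩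
  have hm0 : (0 : ℝ) ≤ m := m.cast_nonneg
  have hG3 : 0 < Gamma (m + α + 1 / 2) := Gamma_pos_of_pos (by linarith)
  have hmn : (m : ℝ) + 1 / 2 ≤ n + 1 := by
    have : m ≤ n := by omega
    have : (m : ℝ) ≤ n := by exact_mod_cast this
    linarith
  -- The Gamma quotient in `|G_{2m}(0)|` grows at most like `(m + 1/2)^(-α)`.
  have h1 := Gamma_add_le_rpow_mul_Gamma (z := m + α + 1 / 2) (s := -α) (by linarith)
    (by linarith)
  rw [show (m : ℝ) + α + 1 / 2 + -α = m + 1 / 2 by ring] at h1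
  have h2 : |(gegenbauer α (2 * m)).eval 0| ≤
      Gamma (α + 1 / 2) / Gamma (1 / 2) * ((n : ℝ) + 1) ^ (-α) := by
    rw [abs_gegenbauer_even_eval_zero hα, div_le_iff₀ (by positivity)]
    calc _ ≤ (((n : ℝ) + 1) ^ (-α) * Gamma (m + α + 1 / 2)) * Gamma (α + 1 / 2) := by
          gcongr
          refine h1.trans ?_
          gcongr
          linarith
      _ = _ := by field_simp
  have h3 := (sq_le_sq (a := √(1 + 2 * α) * (gegenbauer α n).eval x)
    (b := (gegenbauer α (2 * m)).eval 0)).1 (by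
      rw [mul_pow, sq_sqrt (by linarith)]
      exact gegenbauer_sq_le_of_nonpos hα hα0 m n hm hx)
  rw [abs_mul, abs_of_pos hs] at h3
  rw [div_mul_eq_mul_div, le_div_iff₀ hs, mul_comm]
  exact h3.trans h2

lemma exists_abs_radauPoly_le_of_neg (hα : -(1 / 2) < α) (hα0 : α ≤ 0) :
    ∃ K : ℝ, 0 < K ∧ ∀ n : ℕ, 1 ≤ n → ∀ x ∈ Icc (-1 : ℝ) 1,
      |(radauPoly α n).eval x| ≤ K * (n : ℝ) ^ (-α) := by
  obtain ⟨K, hK, h⟩ := exists_abs_gegenbauer_le_of_neg hα hα0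
  refine ⟨2 * K * 3 ^ (-α), by positivity, fun n hn x hx => ?_⟩
  have hn' : (1 : ℝ) ≤ n := by exact_mod_cast hn
  have hα1 : 0 ≤ -α := by linarith
  have h1 := h (n + 1) x hx
  have h0 := h n x hx
  push_cast at h1
  have e1 : ((n : ℝ) + 1 + 1) ^ (-α) ≤ 3 ^ (-α) * (n : ℝ) ^ (-α) := by
    rw [← mul_rpow (by norm_num) (by linarith)]
    exact rpow_le_rpow (by linarith) (by linarith) hα1
  have e0 : ((n : ℝ) + 1) ^ (-α) ≤ 3 ^ (-α) * (n : ℝ) ^ (-α) := by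
    rw [← mul_rpow (by norm_num) (by linarith)]
    exact rpow_le_rpow (by linarith) (by linarith) hα1
  rw [radauPoly, eval_sub]
  calc _ ≤ |(gegenbauer α (n + 1)).eval x| + |(gegenbauer α n).eval x| := abs_sub _ _
    _ ≤ K * (3 ^ (-α) * (n : ℝ) ^ (-α)) + K * (3 ^ (-α) * (n : ℝ) ^ (-α)) :=
      add_le_add (h1.trans (by gcongr)) (h0.trans (by gcongr))
    _ = _ := by ring

lemma abs_radauPoly_le_two (hα : 0 ≤ α) (n : ℕ) {x : ℝ} (hx : x ∈ Icc (-1 : ℝ) 1) :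
    |(radauPoly α n).eval x| ≤ 2 := by
  rw [radauPoly, eval_sub]
  have h1 := abs_gegenbauer_le_one hα (n + 1) hx
  have h0 := abs_gegenbauer_le_one hα n hx
  linarith [abs_sub ((gegenbauer α (n + 1)).eval x) ((gegenbauer α n).eval x)]

lemma supNorm_shiftedRadau_le {b : ℝ} (hb : 0 < b) (n : ℕ) {M : ℝ}
    (h : ∀ x ∈ Icc (-1 : ℝ) 1, |(radauPoly α n).eval x| ≤ M) :
    supNorm (shiftedRadau α b n) (Icc 0 b) ≤ M := by
  refine supNorm_le ((abs_nonneg _).trans (h 0 ⟨by norm_num, by norm_num⟩)) fun t ht => h _ ⟨?_, ?_⟩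
  · have : 0 ≤ 2 * t / b := div_nonneg (by linarith [ht.1]) hb.le
    linarith
  · have : 2 * t / b ≤ 2 := by
      rw [div_le_iff₀ hb]
      linarith [ht.2]
    linarith

/-- A bound `K n^β` for the Radau polynomial on `[-1, 1]` gives a bound for the truncation error. -/
lemma exists_abs_truncError2_le (hα : -(1 / 2) < α) {K β : ℝ} (hK : 0 < K)
    (hq : ∀ n : ℕ, 1 ≤ n → ∀ x ∈ Icc (-1 : ℝ) 1, |(radauPoly α n).eval x| ≤ K * (n : ℝ) ^ β) :
    ∃ D : ℝ, 0 < D ∧ ∀ n : ℕ, 1 ≤ n → ∀ b : ℝ, 0 < b → ∀ f : ℝ → ℝ,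
      ContDiffOn ℝ ((n + 1 : ℕ) : WithTop ℕ∞) f (Icc 0 b) → ∀ i : Fin (n + 1),
      |truncError2 α b n f i| ≤ (4⁻¹ : ℝ) ^ n * b ^ (n + 1) * D * exp 1 ^ n *
        (n : ℝ) ^ (-(n : ℝ) - 3 / 2 + α + β) * shiftedNode α b n i *
        (supNorm (iteratedDerivWithin n f (Icc 0 b)) (Icc 0 b) * (n + 1) +
          b * supNorm (iteratedDerivWithin (n + 1) f (Icc 0 b)) (Icc 0 b)) := by
  obtain ⟨R, hR, hΓ⟩ := exists_Gamma_ratio_le hα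
  have g1 : 0 < Gamma (2 * α + 1) := Gamma_pos_of_pos (by linarith)
  have g2 : 0 < Gamma (α + 1) := Gamma_pos_of_pos (by linarith)
  -- The factors come from the leading coefficient, the Gamma quotient and the bound for `q_n`, in
  -- that order.
  refine ⟨Gamma (α + 1) / (2 * Gamma (2 * α + 1)) * R * K, by positivity, ?_⟩
  intro n hn b hb f hf i
  refine (abs_truncError2_le hα hb n hf i).trans ?_
  set A := supNorm (iteratedDerivWithin n f (Icc 0 b)) (Icc 0 b) * (n + 1) +
    b * supNorm (iteratedDerivWithin (n + 1) f (Icc 0 b)) (Icc 0 b) with hA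
  have hA0 : 0 ≤ A := add_nonneg (mul_nonneg (supNorm_nonneg _ _) (by positivity))
    (mul_nonneg hb.le (supNorm_nonneg _ _))
  have hS := supNorm_shiftedRadau_le hb n (hq n hn)
  have hS0 := supNorm_nonneg (shiftedRadau α b n) (Icc 0 b)
  have hx := shiftedNode_pos hα hb n i
  have hn' : (0 : ℝ) < n := by exact_mod_cast hn
  have hfac := inv_factorial_succ_le hn
  have g3 : 0 < Gamma (n + α + 1) := Gamma_pos_of_pos (by linarith)
  have g4 : 0 < Gamma (n + 2 * α + 1) := Gamma_pos_of_pos (by linarith)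
  have hlead0 := gegenbauerLead_succ_pos hα n
  have hlead : (b / 2) ^ (n + 1) / gegenbauerLead α (n + 1) ≤
      b ^ (n + 1) * (4⁻¹ : ℝ) ^ n * (Gamma (α + 1) / (2 * Gamma (2 * α + 1))) *
        (R * (n : ℝ) ^ α) := by
    have e : (b / 2) ^ (n + 1) / gegenbauerLead α (n + 1) =
        b ^ (n + 1) * (4⁻¹ : ℝ) ^ n * (Gamma (α + 1) / (2 * Gamma (2 * α + 1))) *
          (Gamma (n + 2 * α + 1) / Gamma (n + α + 1)) := by
      rw [gegenbauerLead_succ, show (4⁻¹ : ℝ) = 2⁻¹ * 2⁻¹ by norm_num, mul_pow, div_pow, pow_succ 2 n,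
        inv_pow]
      field_simp
    rw [e]
    gcongr
    rw [div_le_iff₀ g3]
    exact hΓ n hn
  calc A / (Nat.factorial (n + 1)) * ((b / 2) ^ (n + 1) / gegenbauerLead α (n + 1) *
          supNorm (shiftedRadau α b n) (Icc 0 b)) * shiftedNode α b n i
      ≤ A * (exp 1 ^ n * (n : ℝ) ^ (-(n : ℝ) - 3 / 2)) *
        (b ^ (n + 1) * (4⁻¹ : ℝ) ^ n * (Gamma (α + 1) / (2 * Gamma (2 * α + 1))) *
        (R * (n : ℝ) ^ α) * (K * (n : ℝ) ^ β)) * shiftedNode α b n i := by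
        rw [div_eq_mul_inv]
        gcongr
    _ = _ := by
        rw [rpow_add hn', rpow_add hn']
        ring

end Bounds

end SGQuad

/-! ### The three estimates. -/

theorem theorem8 (α : ℝ) (hα : -(1 / 2) < α) :
    (∀ (n : ℕ) (b : ℝ), 0 < b → ∀ (f : ℝ → ℝ), ContDiffOn ℝ ((n + 1 : ℕ) : WithTop ℕ∞) f (Icc 0 b) →
      ∀ A₀ A₁ : ℝ,
      A₀ = SGQuad.supNorm (iteratedDerivWithin n f (Icc 0 b)) (Icc 0 b) →
      A₁ = SGQuad.supNorm (iteratedDerivWithin (n + 1) f (Icc 0 b)) (Icc 0 b) →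
      ∀ i : Fin (n + 1),
        |SGQuad.truncError2 α b n f i| ≤
          (2 : ℝ) ^ (-2 * (n : ℝ) - 1) * SGQuad.shiftedNode α b n i * Gamma (α + 1) * b ^ (n + 1) *
              Gamma ((n : ℝ) + 2 * α + 1) * (A₀ * ((n : ℝ) + 1) + b * A₁) /
            ((Nat.factorial (n + 1) : ℝ) * Gamma (2 * α + 1) * Gamma ((n : ℝ) + α + 1)) *
            SGQuad.supNorm (SGQuad.shiftedRadau α b n) (Icc 0 b)) ∧
    (0 ≤ α → ∃ C : ℝ, 0 < C ∧
      ∀ n : ℕ, 1 ≤ n → ∀ b : ℝ, 0 < b →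
      ∀ f : ℝ → ℝ, ContDiffOn ℝ ((n + 1 : ℕ) : WithTop ℕ∞) f (Icc 0 b) →
      ∀ A₀ A₁ : ℝ,
      A₀ = SGQuad.supNorm (iteratedDerivWithin n f (Icc 0 b)) (Icc 0 b) →
      A₁ = SGQuad.supNorm (iteratedDerivWithin (n + 1) f (Icc 0 b)) (Icc 0 b) →
      ∀ i : Fin (n + 1),
        |SGQuad.truncError2 α b n f i| ≤
          b ^ (n + 1) * C * (exp 1 / 4) ^ n * (n : ℝ) ^ (-(3 / 2) - (n : ℝ) + α) *
            SGQuad.shiftedNode α b n i * (A₀ * ((n : ℝ) + 1) + b * A₁)) ∧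
    (α < 0 → ∃ D : ℝ, 0 < D ∧
      ∀ n : ℕ, 1 ≤ n → ∀ b : ℝ, 0 < b →
      ∀ f : ℝ → ℝ, ContDiffOn ℝ ((n + 1 : ℕ) : WithTop ℕ∞) f (Icc 0 b) →
      ∀ A₀ A₁ : ℝ,
      A₀ = SGQuad.supNorm (iteratedDerivWithin n f (Icc 0 b)) (Icc 0 b) →
      A₁ = SGQuad.supNorm (iteratedDerivWithin (n + 1) f (Icc 0 b)) (Icc 0 b) →
      ∀ i : Fin (n + 1),
        |SGQuad.truncError2 α b n f i| ≤
          (2 : ℝ) ^ (-2 * (n : ℝ) - 1) * b ^ (n + 1) * D * exp 1 ^ n *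
            (n : ℝ) ^ (-(n : ℝ) - 3 / 2) *
            SGQuad.shiftedNode α b n i * (A₀ * ((n : ℝ) + 1) + b * A₁)) := by
  have htwo : ∀ n : ℕ, (2 : ℝ) ^ (-2 * (n : ℝ) - 1) = (4⁻¹ : ℝ) ^ n / 2 := fun n => by
    rw [rpow_sub two_pos, rpow_one, rpow_mul two_pos.le, rpow_natCast]
    norm_num [rpow_neg]
  refine ⟨?_, fun hα0 => ?_, fun hα0 => ?_⟩
  · rintro n b hb f hf _ _ rfl rfl i
    refine (SGQuad.abs_truncError2_le hα hb n hf i).trans (le_of_eq ?_)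
    have hn : (0 : ℝ) ≤ n := n.cast_nonneg
    have g1 : 0 < Gamma (2 * α + 1) := Gamma_pos_of_pos (by linarith)
    have g2 : 0 < Gamma (α + 1) := Gamma_pos_of_pos (by linarith)
    have g3 : 0 < Gamma (n + α + 1) := Gamma_pos_of_pos (by linarith)
    have g4 : 0 < Gamma (n + 2 * α + 1) := Gamma_pos_of_pos (by linarith)
    rw [htwo, SGQuad.gegenbauerLead_succ, show (4⁻¹ : ℝ) = 2⁻¹ * 2⁻¹ by norm_num, mul_pow,
      div_pow, pow_succ 2 n, inv_pow]
    field_simp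
  · obtain ⟨C, hC, h⟩ := SGQuad.exists_abs_truncError2_le hα (K := 2) (β := 0) two_pos
      (fun n _ x hx => by simpa using SGQuad.abs_radauPoly_le_two hα0 n hx)
    refine ⟨C, hC, ?_⟩
    rintro n hn b hb f hf _ _ rfl rfl i
    refine (h n hn b hb f hf i).trans (le_of_eq ?_)
    rw [show -(n : ℝ) - 3 / 2 + α + 0 = -(3 / 2) - n + α by ring, div_pow, inv_pow]
    ring
  · obtain ⟨K, hK, hq⟩ := SGQuad.exists_abs_radauPoly_le_of_neg hα hα0.le
    obtain ⟨D, hD, h⟩ := SGQuad.exists_abs_truncError2_le hα hK hq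
    -- The `2` offsets `2^(-2n-1) = 4^(-n) / 2`.
    refine ⟨2 * D, by positivity, ?_⟩
    rintro n hn b hb f hf _ _ rfl rfl i
    refine (h n hn b hb f hf i).trans (le_of_eq ?_)
    rw [show -(n : ℝ) - 3 / 2 + α + -α = -n - 3 / 2 by ring, htwo]
    ring
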